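/- Conventions. Let $p$ be a prime. For a commutative ring $B$, a $\mathbf G_a$-action on $B$ is a ring homomorphism $E:B\to B[T]$, $E(b)=\sum_i b_iT^i$, with $E(b)|_{T=0}=b$ and $\sum_i E(b_i)(T_1)\,T_2^i=\sum_i b_i(T_1+T_2)^i$ in $B[T_1,T_2]$ for all $b\in B$. Put $B^E=\{b\in B: E(b)=b\}$ and, for $a\in B^E$, $E_a(b)=E(b)|_{T=a}$. If $B$ is an $R$-algebra, $E$ is over $R$ if the image of $R$ lies in $B^E$. An automorphism $\sigma$ of the $R$-algebra $B$ is exponential over $R$ if $\sigma=E_a$ for some $\mathbf G_a$-action $E$ on $B$ over $R$ and some $a\in B^E$. $E$ restricts to a subring $B'\subset B$ if $E(B')\subset B'[T]$. For a $k$-algebra $A$ and $f\in A\setminus\{0\}$, let $\epsilon$ be the automorphism of $A[X]$ over $A$ with $\epsilon(X)=X+f$; $A$ is called $f$-stable over $k$ if the set of the rings $A[X]^E$, where $E$ runs over the $\mathbf G_a$-actions on $A[X]$ over $k$ with $E_\alpha=\epsilon$ for some $\alpha\in A[X]^E$, is equal to $\{A\}$. Construction. Let $R$ be an integral domain of characteristic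 $p$ that is not a field, and $k=Q(R)$. Let $l\ge 0$, $u\in R$ a nonzero non-unit, $d\ge 2$ an integer with $p\nmid d$, and write $\boldsymbol z=z_1,\dots,z_l$. Put $$a=p-2+(p-1)^2(d-1),\qquad b=(p+1)(d-1)+1,$$ $$\lambda=u^{-p-1}y^{p(p-1)}+u^{-2}y^{pa+1},\qquad \widetilde x=x+\lambda,\qquad \widetilde y=y+\widetilde x^{\,d}.$$ Then $k[x,y,\boldsymbol z]=k[\widetilde x,\widetilde y,\boldsymbol z]$. For $g\in R[u^{(p+1)d}\widetilde y,\boldsymbol z]$ let $E^g:k[x,y,\boldsymbol z]\to k[x,y,\boldsymbol z][T]$ be the homomorphism of $k$-algebras with $\widetilde x\mapsto \widetilde x+u^b(1+ug)T$, $\widetilde y\mapsto\widetilde y$, $z_i\mapsto z_i$ for all $i$. Theorem. (1) For all such $l,u,d,g$, the map $E^g$ is a $\mathbf G_a$-action on $k[x,y,\boldsymbol z]$ over $k$; $E^g_1$ restricts to an automorphism $\sigma^g$ of the $R$-algebra $R[x,y,\boldsymbol z]$, and $\sigma^g$ has order $p$; but $E^g$ does not restrict to $R[x,y,\boldsymbol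 z]$. If $R$ is a UFD and $k[\widetilde y,\boldsymbol z]$ is $(1+ug)$-stable over $k$, then $\sigma^g$ is not exponential over $R$. (2) For all such $l,u,d$, the element $g=u^{(p+1)d}\widetilde y z_1\cdots z_l$ belongs to $R[u^{(p+1)d}\widetilde y,\boldsymbol z]$, and for this $g$ the ring $k[\widetilde y,\boldsymbol z]$ is $(1+ug)$-stable over $k$; hence, if $R$ is a UFD, $\sigma^g$ is not exponential over $R$. (3) If $R$ is a UFD, then for every $n\ge 2$ there is an automorphism of the $R$-algebra $R[x_1,\dots,x_n]$ of order $p$ that is not exponential over $R$. -/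

import Mathlib

open Polynomial

noncomputable section

namespace GaNonExp

section GaActions

variable {B : Type*} [CommRing B]

/-- `E : B → B[T]` is an action of the additive group scheme on `Spec B`: the counit axiom
`E_0 = id`, and coassociativity, where `B ⊗ κ[T] ⊗ κ[T]` is identified with `B[T₁][T₂]`;
`E ⊗ id` applies `E` to the coefficients, and `id ⊗ Δ` substitutes `T₁ + T₂` for `T`. -/
structure IsGaAction (E : B →+* B[X]) : Prop where
  counit : ∀ b, (E b).eval 0 = b
  coassoc : ∀ b, (E b).map E =
    (E b).eval₂ ((C : B[X] →+* B[X][X]).comp (C : B →+* B[X])) (C X + X)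

/-- The invariant ring `B^E = {b | E b = b}`. -/
def invariants (E : B →+* B[X]) : Subring B := RingHom.eqLocus E C

/-- `E_a : B → B`, `b ↦ E(b)` evaluated at `T = a` (used for `a ∈ B^E`). -/
def evalAt (E : B →+* B[X]) (a : B) : B →+* B := (evalRingHom a).comp E

/-- `E` restricts to the subring `B'`, i.e. `E(B') ⊆ B'[T]`. -/
def Restricts (E : B →+* B[X]) (B' : Subring B) : Prop :=
  ∀ b ∈ B', ∀ i, (E b).coeff i ∈ B'

variable (R : Type*) [CommRing R] [Algebra R B]

/-- `E` is a `G_a`-action on `B` over `R`: the image of `R` lies in `B^E`. -/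
def IsGaActionOver (E : B →+* B[X]) : Prop :=
  IsGaAction E ∧ ∀ r : R, algebraMap R B r ∈ invariants E

/-- `σ` is exponential over `R`: `σ = E_a` for a `G_a`-action `E` over `R` and some `a ∈ B^E`. -/
def IsExponentialOver (σ : B ≃ₐ[R] B) : Prop :=
  ∃ E : B →+* B[X], IsGaActionOver R E ∧ ∃ a ∈ invariants E, ∀ b, evalAt E a b = σ b

/-- The set `𝒜_R(σ)` of the rings `B^E`, for `E` a `G_a`-action on `B` over `R` such that
`E_α = σ` for some `α ∈ B^E`. -/
def invariantRings (σ : B ≃ₐ[R] B) : Set (Subring B) :=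
  {A | ∃ E : B →+* B[X], IsGaActionOver R E ∧
    (∃ α ∈ invariants E, ∀ b, evalAt E α b = σ b) ∧ invariants E = A}

/-- `A` is `f`-stable over `R`: `𝒜_R(ε) = {A}` for the automorphism `ε : x ↦ x + f` of `A[x]`
over `A`. -/
def IsStable (A : Type*) [CommRing A] [Algebra R A] (f : A) : Prop :=
  invariantRings R ((algEquivAevalXAddC f).restrictScalars R) =
    {(C : A →+* A[X]).range}

end GaActions

section TwoLine

variable {ι K S : Type*} [CommRing K] [CommRing S] [Algebra K S]

/-- For coordinates `e(X_i)` of `K[X]`, the unique homomorphism of `K`-algebras that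
sends the coordinate `e(X_i)` to `v i` for all `i`. -/
def twoLine (e : MvPolynomial ι K ≃ₐ[K] MvPolynomial ι K) (v : ι → S) :
    MvPolynomial ι K →ₐ[K] S :=
  (MvPolynomial.aeval v).comp e.symm.toAlgHom

theorem twoLine_apply (e : MvPolynomial ι K ≃ₐ[K] MvPolynomial ι K) (v : ι → S) (i : ι) :
    twoLine e v (e (MvPolynomial.X i)) = v i := by
  simp [twoLine]

end TwoLine

section Construction

variable {R : Type*} [CommRing R] (K : Type*) [Field K] [Algebra R K]
variable (p l d : ℕ) (u : R)

/-- The variable `z_i` of `K[x, y, z_1, …, z_l]`; the variables `x` and `y` are `X 0`, `X 1`. -/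
def z (i : Fin l) : MvPolynomial (Fin (l + 2)) K := MvPolynomial.X i.succ.succ

/-- `u`, regarded as an element of `K[x, y, z]`. -/
def cst : MvPolynomial (Fin (l + 2)) K := MvPolynomial.C (algebraMap R K u)

/-- `a = p - 2 + (p - 1)² (d - 1)`. -/
def expA : ℕ := p - 2 + (p - 1) ^ 2 * (d - 1)

/-- `b = (p + 1) (d - 1) + 1`. -/
def expB : ℕ := (p + 1) * (d - 1) + 1

/-- `u^{-p-1} t^{p(p-1)} + u^{-2} t^{pa+1}`; for `t = y` this is `λ`. -/
def lam (t : MvPolynomial (Fin (l + 2)) K) : MvPolynomial (Fin (l + 2)) K :=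
  MvPolynomial.C ((algebraMap R K u)⁻¹ ^ (p + 1)) * t ^ (p * (p - 1)) +
    MvPolynomial.C ((algebraMap R K u)⁻¹ ^ 2) * t ^ (p * expA p d + 1)

/-- `x̃ = x + λ`. -/
def xt : MvPolynomial (Fin (l + 2)) K :=
  MvPolynomial.X 0 + lam K p l d u (MvPolynomial.X 1)

/-- `ỹ = y + x̃^d`. -/
def yt : MvPolynomial (Fin (l + 2)) K := MvPolynomial.X 1 + xt K p l d u ^ d

/-- The tuple `x̃, ỹ, z_1, …, z_l`. -/
def coords : Fin (l + 2) → MvPolynomial (Fin (l + 2)) K :=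
  Fin.cons (xt K p l d u) (Fin.cons (yt K p l d u) (z K l))

/-- The polynomials expressing `x, y, z_1, …, z_l` through `x̃, ỹ, z_1, …, z_l`. -/
def coordsInv : Fin (l + 2) → MvPolynomial (Fin (l + 2)) K :=
  Fin.cons (MvPolynomial.X 0 - lam K p l d u (MvPolynomial.X 1 - MvPolynomial.X 0 ^ d))
    (Fin.cons (MvPolynomial.X 1 - MvPolynomial.X 0 ^ d) (z K l))

theorem coords_zero : coords K p l d u 0 = xt K p l d u := rfl

theorem coords_one : coords K p l d u 1 = yt K p l d u := rfl

theorem coordsInv_zero : coordsInv K p l d u 0 =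
    MvPolynomial.X 0 - lam K p l d u (MvPolynomial.X 1 - MvPolynomial.X 0 ^ d) := rfl

theorem coordsInv_one : coordsInv K p l d u 1 = MvPolynomial.X 1 - MvPolynomial.X 0 ^ d := rfl

theorem map_lam (φ : MvPolynomial (Fin (l + 2)) K →ₐ[K] MvPolynomial (Fin (l + 2)) K)
    (t : MvPolynomial (Fin (l + 2)) K) : φ (lam K p l d u t) = lam K p l d u (φ t) := by
  simp only [lam, map_add, map_mul, map_pow, MvPolynomial.algHom_C, MvPolynomial.algebraMap_eq]

theorem coords_comp_coordsInv (i : Fin (l + 2)) :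
    MvPolynomial.aeval (coords K p l d u) (coordsInv K p l d u i) = MvPolynomial.X i := by
  have h1 : MvPolynomial.aeval (coords K p l d u)
      ((MvPolynomial.X 1 : MvPolynomial (Fin (l + 2)) K) - MvPolynomial.X 0 ^ d) =
        MvPolynomial.X 1 := by
    rw [map_sub, map_pow, MvPolynomial.aeval_X, MvPolynomial.aeval_X, coords_zero, coords_one,
      yt, add_sub_cancel_right]
  refine Fin.cases ?_ (fun i => Fin.cases ?_ (fun i => ?_) i) i
  · rw [coordsInv_zero, map_sub, map_lam, h1, MvPolynomial.aeval_X, coords_zero, xt,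
      add_sub_cancel_right]
  · exact h1
  · exact MvPolynomial.aeval_X _ (Fin.succ (Fin.succ i))

theorem coordsInv_comp_coords (i : Fin (l + 2)) :
    MvPolynomial.aeval (coordsInv K p l d u) (coords K p l d u i) = MvPolynomial.X i := by
  have h0 : MvPolynomial.aeval (coordsInv K p l d u) (xt K p l d u) = MvPolynomial.X 0 := by
    rw [xt, map_add, map_lam, MvPolynomial.aeval_X, MvPolynomial.aeval_X, coordsInv_zero,
      coordsInv_one, sub_add_cancel]
  refine Fin.cases ?_ (fun i => Fin.cases ?_ (fun i => ?_) i) i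
  · exact h0
  · change MvPolynomial.aeval (coordsInv K p l d u) (yt K p l d u) = MvPolynomial.X 1
    rw [yt, map_add, map_pow, h0, MvPolynomial.aeval_X, coordsInv_one, sub_add_cancel]
  · exact MvPolynomial.aeval_X _ (Fin.succ (Fin.succ i))

/-- `K[x, y, z] = K[x̃, ỹ, z]`: the automorphism with `x ↦ x̃`, `y ↦ ỹ`, `z_i ↦ z_i`. -/
def coordEquiv : MvPolynomial (Fin (l + 2)) K ≃ₐ[K] MvPolynomial (Fin (l + 2)) K :=
  AlgEquiv.ofAlgHom (MvPolynomial.aeval (coords K p l d u))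
    (MvPolynomial.aeval (coordsInv K p l d u))
    (MvPolynomial.algHom_ext fun i => by
      rw [AlgHom.comp_apply, MvPolynomial.aeval_X, coords_comp_coordsInv, AlgHom.id_apply])
    (MvPolynomial.algHom_ext fun i => by
      rw [AlgHom.comp_apply, MvPolynomial.aeval_X, coordsInv_comp_coords, AlgHom.id_apply])

theorem coordEquiv_X (i : Fin (l + 2)) :
    coordEquiv K p l d u (MvPolynomial.X i) = coords K p l d u i := by
  simp [coordEquiv]

/-- The ring `R[u^{(p+1)d} ỹ, z_1, …, z_l]` in which `g` is chosen. -/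
def gRing : Subalgebra R (MvPolynomial (Fin (l + 2)) K) :=
  Algebra.adjoin R
    (insert (cst K l u ^ ((p + 1) * d) * yt K p l d u) (Set.range (z K l)))

/-- The ring `K[ỹ, z_1, …, z_l]`. -/
def invRing : Subalgebra K (MvPolynomial (Fin (l + 2)) K) :=
  Algebra.adjoin K (insert (yt K p l d u) (Set.range (z K l)))

/-- The `G_a`-action `E^g`: `x̃ ↦ x̃ + u^b (1 + u g) T`, `ỹ ↦ ỹ`, `z_i ↦ z_i`. -/
def actionE (g : MvPolynomial (Fin (l + 2)) K) :
    MvPolynomial (Fin (l + 2)) K →ₐ[K] (MvPolynomial (Fin (l + 2)) K)[X] :=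
  twoLine (coordEquiv K p l d u)
    (Fin.cons (C (xt K p l d u) + C (cst K l u ^ expB p d * (1 + cst K l u * g)) * X)
      (Fin.cons (C (yt K p l d u)) (fun i => C (z K l i))))

/-- `1 + u g` lies in `K[ỹ, z]`. -/
theorem one_add_mem {g : MvPolynomial (Fin (l + 2)) K} (hg : g ∈ gRing K p l d u) :
    1 + cst K l u * g ∈ invRing K p l d u := by
  have hc : cst K l u ∈ invRing K p l d u := Subalgebra.algebraMap_mem _ (algebraMap R K u)
  have hle : g ∈ invRing K p l d u := by
    refine Algebra.adjoin_induction (p := fun q _ => q ∈ invRing K p l d u)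
      ?_ ?_ (fun _ _ _ _ h₁ h₂ => add_mem h₁ h₂) (fun _ _ _ _ h₁ h₂ => mul_mem h₁ h₂) hg
    · rintro _ (rfl | h)
      · exact mul_mem (pow_mem hc _) (Algebra.subset_adjoin (Set.mem_insert _ _))
      · exact Algebra.subset_adjoin (Set.mem_insert_of_mem _ h)
    · intro r
      exact Subalgebra.algebraMap_mem (invRing K p l d u) (algebraMap R K r)
  exact add_mem (one_mem _) (mul_mem hc hle)

/-- The subring `R[x_1, …, x_n]` of `K[x_1, …, x_n]`. -/
def intRing (R K : Type*) [CommRing R] [Field K] [Algebra R K] (n : ℕ) :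
    Subring (MvPolynomial (Fin n) K) :=
  (MvPolynomial.map (algebraMap R K)).range

/-- The automorphism `σ` of `R[x_1, …, x_n]` is the restriction of the endomorphism `φ` of
`K[x_1, …, x_n]`. -/
def IsRestriction {n : ℕ} (φ : MvPolynomial (Fin n) K →+* MvPolynomial (Fin n) K)
    (σ : MvPolynomial (Fin n) R ≃ₐ[R] MvPolynomial (Fin n) R) : Prop :=
  ∀ q, MvPolynomial.map (algebraMap R K) (σ q) = φ (MvPolynomial.map (algebraMap R K) q)

/-- The element `u^{(p+1)d} ỹ z_1 ⋯ z_l`. -/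
def specialG : MvPolynomial (Fin (l + 2)) K :=
  cst K l u ^ ((p + 1) * d) * yt K p l d u * ∏ i, z K l i

end Construction

end GaNonExp

end

/-! Non-exponentiality is a contradiction in valuations. If `σ` were `F_α` for an action over `R`,
base change to `K` would give an action `E` with `E_α = E^g_1`. Stability puts `ỹ` into the
invariants of `E` (`yt_mem_invariants_of_isStable`), so `E` is described by one polynomial `c` in
`T`: `E(x̃) = x̃ + c`, `c(0) = 0`, `c(α) = u^b (1 + u g)`. Take a valuation (written
multiplicatively) with `v ≤ 1` on `R`, `v(u) < 1` and value `1` on every variable; then `v(c(α)) =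
v(u)^b`.

On the other hand `E(x)` and `E(y)` are integral. The increment `D` of `y` has the size of `x̃^(d-1)
c`. The increment of `λ` is, to leading order, `-u^(-p-1) y^(p(p-2)) D^p + u^(-2) y^(pa) D`. As
polynomials in `T` these two terms cannot cancel, because `D^p` and `D` behave differently in `T`.
To make this rigorous, the Gauss valuation is refined by a radius infinitesimally larger than `1`
(`exists_refined_gaussValuation`). Hence `u^(-2) D` alone is integral, which forces `v(c(α)) <
v(u)^b` (`valuation_lt_of_integral`, `valuation_eval_lt`).

At `T = 1` in `E^g` the two terms do cancel modulo integral elements: there `D = u D'` with `D' ≡ -d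
y^(p(p-1)(d-1))` modulo `u`, `-d` is fixed by Frobenius, and `a` is the exponent that makes the
powers of `y` agree (`exists_integral_increments`). So `E^g_1` is integral, while the coefficient of
`T` in `E^g(x)` keeps a pole along `u`.

Stability for the special `g` holds because `f = 1 + u g` is invariant under every action containing
`ε` (`IsGaAction.difference_mem`). Then `f - 1` is invariant, and so are its factors `ỹ, z_1, …,
z_l`, since rings of invariants are factorially closed. -/

noncomputable section

namespace GaNonExp

/-! ### Gauss valuations of arbitrary radius on polynomial rings. -/

section Gauss

variable {A Γ : Type*} [CommRing A] [LinearOrderedCommGroupWithZero Γ]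

/-- The Gauss norm of radius `t` with respect to the valuation `v`. -/
def gaussFun (v : Valuation A Γ) (t : Γ) (P : A[X]) : Γ :=
  P.support.sup fun i => v (P.coeff i) * t ^ i

theorem le_gaussFun (v : Valuation A Γ) (t : Γ) (P : A[X]) (i : ℕ) :
    v (P.coeff i) * t ^ i ≤ gaussFun v t P := by
  by_cases hi : i ∈ P.support
  · exact Finset.le_sup (f := fun i => v (P.coeff i) * t ^ i) hi
  · rw [notMem_support_iff.1 hi, map_zero, zero_mul]
    exact zero_le

theorem gaussFun_le_iff (v : Valuation A Γ) (t : Γ) (P : A[X]) (g : Γ) :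
    gaussFun v t P ≤ g ↔ ∀ i, v (P.coeff i) * t ^ i ≤ g :=
  ⟨fun h i => (le_gaussFun v t P i).trans h, fun h => Finset.sup_le fun i _ => h i⟩

theorem exists_gaussFun_eq (v : Valuation A Γ) (t : Γ) (P : A[X]) :
    ∃ i, gaussFun v t P = v (P.coeff i) * t ^ i := by
  rcases P.support.eq_empty_or_nonempty with h | h
  · refine ⟨0, ?_⟩
    rw [support_eq_empty.1 h]
    simp [gaussFun, le_antisymm bot_le zero_le]
  · obtain ⟨i, -, hi⟩ := P.support.exists_mem_eq_sup h fun i => v (P.coeff i) * t ^ i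
    exact ⟨i, hi⟩

/-- The last dominant index serves the Gauss lemma: in the coefficient of a product at the sum of
two such indices, one term strictly dominates. -/
theorem exists_gaussFun_eq_last (v : Valuation A Γ) (t : Γ) (P : A[X])
    (hP : gaussFun v t P ≠ 0) :
    ∃ i, gaussFun v t P = v (P.coeff i) * t ^ i ∧
      ∀ k, i < k → v (P.coeff k) * t ^ k < gaussFun v t P := by
  obtain ⟨i₀, h₀⟩ := exists_gaussFun_eq v t P
  have hmem : ∀ i, gaussFun v t P = v (P.coeff i) * t ^ i → i ∈ P.support := by
    intro i hi
    rw [mem_support_iff]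
    rintro h
    rw [h, map_zero, zero_mul] at hi
    exact hP hi
  classical
  have hne : (P.support.filter fun i => gaussFun v t P = v (P.coeff i) * t ^ i).Nonempty :=
    ⟨i₀, Finset.mem_filter.2 ⟨hmem _ h₀, h₀⟩⟩
  refine ⟨_, (Finset.mem_filter.1 (Finset.max'_mem _ hne)).2, fun k hk => ?_⟩
  refine lt_of_le_of_ne (le_gaussFun v t P k) fun h => ?_
  exact absurd (Finset.le_max' _ k (Finset.mem_filter.2 ⟨hmem _ h.symm, h.symm⟩)) (not_le.2 hk)

theorem gaussFun_mul (v : Valuation A Γ) {t : Γ} (ht : t ≠ 0) (P Q : A[X]) :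
    gaussFun v t (P * Q) = gaussFun v t P * gaussFun v t Q := by
  classical
  have hterm : ∀ i j, v (P.coeff i * Q.coeff j) * t ^ (i + j) =
      (v (P.coeff i) * t ^ i) * (v (Q.coeff j) * t ^ j) := fun i j => by
    rw [map_mul, pow_add, mul_mul_mul_comm]
  apply le_antisymm
  · rw [gaussFun_le_iff]
    intro n
    have htn : 0 < t ^ n := zero_lt_iff.2 (pow_ne_zero _ ht)
    rw [← le_div_iff₀ htn, coeff_mul]
    refine v.map_sum_le fun x hx => ?_
    rw [le_div_iff₀ htn, ← Finset.HasAntidiagonal.mem_antidiagonal.1 hx, hterm]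
    exact mul_le_mul' (le_gaussFun _ _ _ _) (le_gaussFun _ _ _ _)
  · by_cases hP : gaussFun v t P = 0
    · rw [hP, zero_mul]; exact zero_le
    by_cases hQ : gaussFun v t Q = 0
    · rw [hQ, mul_zero]; exact zero_le
    obtain ⟨i, hi, hi'⟩ := exists_gaussFun_eq_last v t P hP
    obtain ⟨j, hj, hj'⟩ := exists_gaussFun_eq_last v t Q hQ
    have htn : 0 < t ^ (i + j) := zero_lt_iff.2 (pow_ne_zero _ ht)
    have key : v ((P * Q).coeff (i + j)) = v (P.coeff i * Q.coeff j) := by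
      rw [coeff_mul]
      refine v.map_sum_eq_of_lt (j := (i, j))
        (f := fun x : ℕ × ℕ => P.coeff x.1 * Q.coeff x.2)
        (Finset.HasAntidiagonal.mem_antidiagonal.2 rfl) ?_
      · rintro ⟨k, m⟩ hkm
        obtain ⟨hkm, hne⟩ := Finset.mem_sdiff.1 hkm
        have hkm : k + m = i + j := Finset.HasAntidiagonal.mem_antidiagonal.1 hkm
        refine lt_of_mul_lt_mul_right (a := t ^ (i + j)) ?_ zero_le
        rw [hterm, ← hi, ← hj, ← hkm, hterm]
        have hne' : (k, m) ≠ (i, j) := fun h => hne (Finset.mem_singleton.2 h)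
        -- Any other pair with sum `i + j` passes the last dominant index in one of its two entries.
        rcases lt_trichotomy i k with h | h | h
        · exact mul_lt_mul_of_lt_of_le_of_nonneg_of_pos (hi' k h) (le_gaussFun _ _ _ _)
            zero_le (zero_lt_iff.2 hQ)
        · subst h
          exact absurd (by rw [Nat.add_left_cancel hkm]) hne'
        · exact mul_lt_mul_of_le_of_lt_of_nonneg_of_pos (le_gaussFun _ _ _ _)
            (hj' m (by omega)) zero_le (zero_lt_iff.2 hP)
    rw [hi, hj, ← hterm, ← key]
    exact le_gaussFun _ _ _ _

theorem gaussFun_C (v : Valuation A Γ) (t : Γ) (a : A) : gaussFun v t (C a) = v a := by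
  apply le_antisymm
  · rw [gaussFun_le_iff]
    rintro (_ | i)
    · simp
    · rw [coeff_C_succ, map_zero, zero_mul]; exact zero_le
  · simpa using le_gaussFun v t (C a) 0

/-- The Gauss valuation of radius `t ≠ 0` on `A[X]` extending the valuation `v` of `A`. -/
def gaussValuation (v : Valuation A Γ) {t : Γ} (ht : t ≠ 0) : Valuation A[X] Γ where
  toFun := gaussFun v t
  map_zero' := by simp [gaussFun, le_antisymm bot_le zero_le]
  map_one' := by rw [← C_1, gaussFun_C, map_one]
  map_mul' := gaussFun_mul v ht
  map_add_le_max' P Q := by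
    change gaussFun v t (P + Q) ≤ _
    rw [gaussFun_le_iff]
    intro i
    rw [coeff_add]
    refine (mul_le_mul_left (v.map_add _ _) _).trans ?_
    rcases le_total (v (P.coeff i)) (v (Q.coeff i)) with h | h
    · rw [max_eq_right h]
      exact (le_gaussFun v t Q i).trans (le_max_right _ _)
    · rw [max_eq_left h]
      exact (le_gaussFun v t P i).trans (le_max_left _ _)

theorem gaussValuation_C (v : Valuation A Γ) {t : Γ} (ht : t ≠ 0) (a : A) :
    gaussValuation v ht (C a) = v a := gaussFun_C v t a

theorem gaussValuation_X (v : Valuation A Γ) {t : Γ} (ht : t ≠ 0) :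
    gaussValuation v ht X = t := by
  change gaussFun v t X = t
  apply le_antisymm
  · rw [gaussFun_le_iff]
    intro i
    rw [coeff_X]
    split_ifs with h
    · subst h; simp
    · rw [map_zero, zero_mul]; exact zero_le
  · simpa using le_gaussFun v t X 1

theorem exists_mvPolynomial_valuation {K : Type*} [CommRing K] (v : Valuation K Γ) (n : ℕ) :
    ∃ w : Valuation (MvPolynomial (Fin n) K) Γ,
      (∀ a, w (MvPolynomial.C a) = v a) ∧ ∀ i, w (MvPolynomial.X i) = 1 := by
  induction n with
  | zero =>
    refine ⟨v.comap (MvPolynomial.isEmptyAlgEquiv K (Fin 0)).toRingHom, fun a => ?_,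
      fun i => i.elim0⟩
    change v (MvPolynomial.isEmptyAlgEquiv K (Fin 0) (algebraMap K _ a)) = v a
    rw [AlgEquiv.commutes, Algebra.algebraMap_self_apply]
  | succ n ih =>
    obtain ⟨w, hw, hw'⟩ := ih
    refine ⟨(gaussValuation w one_ne_zero).comap (MvPolynomial.finSuccEquiv K n).toRingHom,
      fun a => ?_, fun i => ?_⟩
    · simp [Valuation.comap_apply, gaussValuation_C, hw, MvPolynomial.finSuccEquiv_apply]
    · rw [Valuation.comap_apply]
      refine Fin.cases ?_ (fun i => ?_) i
      · simp [MvPolynomial.finSuccEquiv_X_zero, gaussValuation_X]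
      · simp [MvPolynomial.finSuccEquiv_X_succ, gaussValuation_C, hw']

end Gauss

/-- A non-unit of a subring of a field has value less than `1` for some valuation which is at
most `1` on the subring. -/
theorem exists_valuation_lt_one {R : Type*} {K : Type*} [CommRing R] [Field K] [Algebra R K]
    [IsDomain R] [IsFractionRing R K] {u : R} (hu : ¬ IsUnit u) :
    ∃ V : ValuationSubring K, (∀ r : R, V.valuation (algebraMap R K r) ≤ 1) ∧
      V.valuation (algebraMap R K u) < 1 := by
  have hinj := IsFractionRing.injective R K
  let e : R ≃+* (algebraMap R K).range :=
    RingEquiv.ofBijective (algebraMap R K).rangeRestrict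
      ⟨fun a b h => hinj (congrArg Subtype.val h), (algebraMap R K).rangeRestrict_surjective⟩
  have hI : Ideal.span {e u} ≠ ⊤ := by
    rw [Ne, Ideal.span_singleton_eq_top]
    exact fun h => hu ((MulEquiv.isUnit_map e).1 h)
  -- Some valuation ring contains the image of `R` and has the proper ideal `(u)` among its
  -- non-units.
  obtain ⟨V, hV, hVI⟩ := Ideal.image_subset_nonunits_valuationSubring _ hI
  refine ⟨V, fun r => (V.valuation_le_one_iff _).2 (hV ⟨r, rfl⟩), ?_⟩
  have := hVI ⟨e u, Ideal.mem_span_singleton_self _, rfl⟩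
  exact V.mem_nonunits_iff.1 this

/-! ### Integers prime to `p` in characteristic `p`. -/

section CharPLemmas

variable {L : Type*} [CommRing L] (p : ℕ) [Fact p.Prime] [CharP L p]

theorem natCast_pow_sub_one {n : ℕ} (hn : ¬ p ∣ n) : (n : L) ^ (p - 1) = 1 := by
  have h : (n : ZMod p) ≠ 0 := fun h => hn ((ZMod.natCast_eq_zero_iff _ _).1 h)
  have := congrArg (ZMod.castHom dvd_rfl L) (ZMod.pow_card_sub_one_eq_one h)
  rwa [map_pow, map_natCast, map_one] at this

theorem isUnit_natCast {n : ℕ} (hn : ¬ p ∣ n) : IsUnit (n : L) :=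
  IsUnit.of_pow_eq_one (natCast_pow_sub_one p hn)
    (Nat.sub_ne_zero_of_lt (Fact.out : p.Prime).one_lt)

theorem valuation_natCast {Γ : Type*} [LinearOrderedCommGroupWithZero Γ] (w : Valuation L Γ)
    {n : ℕ} (hn : ¬ p ∣ n) : w (n : L) = 1 := by
  have h := congrArg w (natCast_pow_sub_one (L := L) p hn)
  rw [map_pow, map_one] at h
  exact (pow_eq_one_iff.1 h).resolve_right
    (Nat.sub_ne_zero_of_lt (Fact.out : p.Prime).one_lt)

end CharPLemmas

/-! ### Size of `(x + c)^n - x^n` for a valuation. -/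

section Ultrametric

variable {L Γ : Type*} [CommRing L] [LinearOrderedCommGroupWithZero Γ] (w : Valuation L Γ)

theorem valuation_add_pow_sub_pow_lt {x c : L} (h : w c < w x) (n : ℕ) :
    w ((x + c) ^ n - x ^ n) < w x ^ n := by
  have hx : 0 < w x := lt_of_le_of_lt zero_le h
  induction n with
  | zero => simp
  | succ n ih =>
    have e : (x + c) ^ (n + 1) - x ^ (n + 1) = (x + c) * ((x + c) ^ n - x ^ n) + c * x ^ n := by
      ring
    rw [e]
    refine w.map_add_lt ?_ ?_
    · rw [map_mul, w.map_add_eq_of_lt_left h, pow_succ']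
      exact mul_lt_mul_of_pos_left ih hx
    · rw [map_mul, map_pow, pow_succ']
      exact mul_lt_mul_of_pos_right h (pow_pos hx n)

/-- The difference is `c` times a sum of `n` products, each equal to `x^(n-1)` up to a smaller
error; since `n` has value `1`, the sum has the size of `n x^(n-1)`. -/
theorem valuation_add_pow_sub_pow {x c : L} (h : w c < w x) {n : ℕ} (hn : w (n : L) = 1) :
    w ((x + c) ^ n - x ^ n) = w x ^ (n - 1) * w c := by
  have hx : 0 < w x := lt_of_le_of_lt zero_le h
  have e : (x + c) ^ n - x ^ n =
      (∑ i ∈ Finset.range n, (x + c) ^ i * x ^ (n - 1 - i)) * c := by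
    have := geom_sum₂_mul (x + c) x n
    rw [add_sub_cancel_left] at this
    exact this.symm
  have hs : w (∑ i ∈ Finset.range n, (x + c) ^ i * x ^ (n - 1 - i)) =
      w ((n : L) * x ^ (n - 1)) := by
    apply w.map_eq_of_sub_lt
    rw [map_mul, hn, one_mul, map_pow]
    have : (∑ i ∈ Finset.range n, (x + c) ^ i * x ^ (n - 1 - i)) - (n : L) * x ^ (n - 1) =
        ∑ i ∈ Finset.range n, ((x + c) ^ i * x ^ (n - 1 - i) - x ^ (n - 1)) := by
      rw [Finset.sum_sub_distrib, Finset.sum_const, Finset.card_range, nsmul_eq_mul]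
    rw [this]
    refine w.map_sum_lt (pow_pos hx _).ne' fun i hi => ?_
    have hi : i + (n - 1 - i) = n - 1 := by have := Finset.mem_range.1 hi; omega
    have e : (x + c) ^ i * x ^ (n - 1 - i) - x ^ (n - 1) =
        ((x + c) ^ i - x ^ i) * x ^ (n - 1 - i) := by
      rw [sub_mul, ← pow_add, hi]
    rw [e, map_mul, map_pow, ← hi, pow_add, hi]
    exact mul_lt_mul_of_pos_right (valuation_add_pow_sub_pow_lt w h i) (pow_pos hx _)
  rw [e, map_mul, hs, map_mul, hn, one_mul, map_pow]

theorem valuation_add_pow_sub_pow_of_lt {x c : L} (h : w x < w c) {n : ℕ} (hn : n ≠ 0) :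
    w ((x + c) ^ n - x ^ n) = w c ^ n := by
  have h' : w ((x + c) ^ n) = w c ^ n := by rw [map_pow, w.map_add_eq_of_lt_right h]
  have : w (x ^ n) < w ((x + c) ^ n) := by
    rw [h', map_pow]
    exact pow_lt_pow_left₀ h zero_le hn
  rw [w.map_sub_eq_of_lt_left this, h']

end Ultrametric

/-! ### The key estimate: integrality bounds the translation of `x̃`. -/

section KeyEstimate

variable {L Γ Γ' : Type*} [CommRing L] [LinearOrderedCommGroupWithZero Γ]
  [LinearOrderedCommGroupWithZero Γ'] (p : ℕ) [Fact p.Prime] [CharP L p]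

/-- If the action `x̃ ↦ x̃ + c`, `ỹ ↦ ỹ` is integral on `x` and `y` for the valuation `w₁`,
then `c` is divisible by more than `u ^ b`. The finer valuation `w` excludes cancellations. -/
theorem valuation_lt_of_integral (w : Valuation L Γ) (w₁ : Valuation L Γ')
    (hmon : ∀ f g, w f ≤ w g → w₁ f ≤ w₁ g) {U V X Y c xt : L} {a d : ℕ} (hUV : U * V = 1)
    (hU : w₁ U < 1) (hX : w X ≤ 1) (hY : w Y = 1) (hd : ¬ p ∣ d)
    (hxt : xt = X + (V ^ (p + 1) * Y ^ (p * (p - 1)) + V ^ 2 * Y ^ (p * a + 1)))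
    (hc : ∀ n i j : ℕ, n ≠ 0 → w c ^ n * w V ^ i ≠ w V ^ j)
    (hy : w₁ (Y + xt ^ d - (xt + c) ^ d) ≤ 1)
    (hx : w₁ (xt + c - (V ^ (p + 1) * (Y + xt ^ d - (xt + c) ^ d) ^ (p * (p - 1)) +
      V ^ 2 * (Y + xt ^ d - (xt + c) ^ d) ^ (p * a + 1))) ≤ 1) :
    w₁ c < w₁ U ^ ((p + 1) * (d - 1) + 1) := by
  have hp2 : 2 ≤ p := (Fact.out : p.Prime).two_le
  have hd0 : d ≠ 0 := by rintro rfl; exact hd (dvd_zero p)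
  have hmon' : ∀ f g, w f = w g → w₁ f = w₁ g := fun f g h =>
    le_antisymm (hmon _ _ h.le) (hmon _ _ h.ge)
  have hwU : w U < 1 := by
    by_contra h
    have := hmon 1 U (by rwa [map_one, ← not_lt])
    rw [map_one] at this
    exact absurd hU (not_lt.2 this)
  have hr : w U * w V = 1 := by rw [← map_mul, hUV, map_one]
  have hr₁ : w₁ U * w₁ V = 1 := by rw [← map_mul, hUV, map_one]
  have hU0 : 0 < w U := zero_lt_iff.2 (left_ne_zero_of_mul_eq_one hr)
  have hU₁0 : 0 < w₁ U := zero_lt_iff.2 (left_ne_zero_of_mul_eq_one hr₁)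
  have hV0 : 0 < w V := zero_lt_iff.2 (right_ne_zero_of_mul_eq_one hr)
  have hV₁0 : 0 < w₁ V := zero_lt_iff.2 (right_ne_zero_of_mul_eq_one hr₁)
  have hV₁ : 1 < w₁ V := by
    by_contra h
    exact absurd hr₁ (mul_lt_one_of_lt_of_le hU (not_lt.1 h)).ne
  have hY₁ : w₁ Y = 1 := by rw [← map_one w₁]; exact hmon' _ _ (by rw [hY, map_one])
  -- the value of `xt`
  obtain ⟨N, hN⟩ : ∃ N, N = U ^ (p + 1) * X + (Y ^ (p * (p - 1)) +
      U ^ (p - 1) * Y ^ (p * a + 1)) := ⟨_, rfl⟩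
  have hxtN : xt = V ^ (p + 1) * N := by
    have e1 : V ^ (p + 1) * U ^ (p + 1) = 1 := by rw [← mul_pow, mul_comm, hUV, one_pow]
    have e2 : V ^ (p + 1) * U ^ (p - 1) = V ^ 2 := by
      have : p + 1 = 2 + (p - 1) := by omega
      rw [this, pow_add, mul_assoc, ← mul_pow, mul_comm V U, hUV, one_pow, mul_one]
    rw [hxt, hN]
    linear_combination (-X) * e1 - Y ^ (p * a + 1) * e2
  have hwN : w N = 1 := by
    have h1 : w (Y ^ (p * (p - 1))) = 1 := by rw [map_pow, hY, one_pow]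
    have : w (N - Y ^ (p * (p - 1))) < w (Y ^ (p * (p - 1))) := by
      have e : N - Y ^ (p * (p - 1)) = U ^ (p + 1) * X + U ^ (p - 1) * Y ^ (p * a + 1) := by
        rw [hN]; ring
      rw [e, h1]
      refine w.map_add_lt ?_ ?_
      · rw [map_mul, map_pow]
        exact mul_lt_one_of_lt_of_le (pow_lt_one₀ zero_le hwU (by omega)) hX
      · rw [map_mul, map_pow, map_pow, hY, one_pow, mul_one]
        exact pow_lt_one₀ zero_le hwU (by omega)
    rw [w.map_eq_of_sub_lt this, h1]
  have hwN₁ : w₁ N = 1 := by rw [← map_one w₁]; exact hmon' _ _ (by rw [hwN, map_one])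
  have hwx : w xt = w V ^ (p + 1) := by rw [hxtN, map_mul, map_pow, hwN, mul_one]
  have hwx₁ : w₁ xt = w₁ V ^ (p + 1) := by rw [hxtN, map_mul, map_pow, hwN₁, mul_one]
  -- the increment of `y`
  obtain ⟨D, hD⟩ : ∃ D, D = -((xt + c) ^ d - xt ^ d) := ⟨_, rfl⟩
  have hYD : Y + xt ^ d - (xt + c) ^ d = Y + D := by rw [hD]; ring
  rw [hYD] at hx hy
  have hD₁ : w₁ D ≤ 1 := by
    rw [← add_sub_cancel_left Y D]
    exact w₁.map_sub_le hy hY₁.le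
  -- Otherwise `c` dominates `x̃`, and `D` is at least as large as `x̃^d`, against integrality of `y
  -- + D`. Equality of values is excluded by `hc`.
  have hcx : w c < w xt := by
    by_contra h
    have hlt : w xt < w c := lt_of_le_of_ne (not_lt.1 h) fun h => by
      have := hc 1 0 (p + 1) one_ne_zero
      rw [pow_one, pow_zero, mul_one, ← h] at this
      exact this hwx
    have h1 : w (xt ^ d) ≤ w D := by
      rw [hD, w.map_neg, valuation_add_pow_sub_pow_of_lt w hlt hd0, map_pow]
      exact pow_le_pow_left₀ zero_le hlt.le d
    have h2 := (hmon _ _ h1).trans hD₁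
    rw [map_pow, hwx₁, ← pow_mul] at h2
    exact absurd h2 (not_le.2 (one_lt_pow₀ hV₁ (Nat.mul_ne_zero (by omega) hd0)))
  have hwD : w D = w xt ^ (d - 1) * w c := by
    rw [hD, w.map_neg, valuation_add_pow_sub_pow w hcx (valuation_natCast p w hd)]
  have hwD₁ : w₁ D = w₁ xt ^ (d - 1) * w₁ c := by
    rw [← map_pow, ← map_mul]
    exact hmon' _ _ (by rw [hwD, map_mul, map_pow])
  rcases eq_or_ne (w c) 0 with hc0 | hc0
  · have : w₁ c = 0 := by
      have := hmon c 0 (by rw [hc0, map_zero])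
      rw [map_zero] at this
      exact le_antisymm this zero_le
    rw [this]
    exact pow_pos hU₁0 _
  have hD0 : w D ≠ 0 := by
    rw [hwD, hwx]
    exact mul_ne_zero (pow_ne_zero _ (pow_ne_zero _ hV0.ne')) hc0
  have hc₁ : w₁ c ≤ 1 := by
    have h1 : w₁ c ≤ w₁ D := by
      rw [hwD₁, hwx₁, ← pow_mul]
      exact le_mul_of_one_le_left zero_le (one_le_pow₀ hV₁.le)
    exact h1.trans hD₁
  have hX₁ : w₁ X ≤ 1 := by
    rw [← map_one w₁]
    exact hmon _ _ (by rwa [map_one])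
  obtain ⟨F₁, hF₁⟩ : ∃ F, F = V ^ (p + 1) * ((Y + D) ^ (p * (p - 1)) - Y ^ (p * (p - 1))) :=
    ⟨_, rfl⟩
  obtain ⟨F₂, hF₂⟩ : ∃ F, F = V ^ 2 * ((Y + D) ^ (p * a + 1) - Y ^ (p * a + 1)) := ⟨_, rfl⟩
  have hF : w₁ (F₁ + F₂) ≤ 1 := by
    have e : F₁ + F₂ = (X + c) - (xt + c - (V ^ (p + 1) * (Y + D) ^ (p * (p - 1)) +
        V ^ 2 * (Y + D) ^ (p * a + 1))) := by
      rw [hF₁, hF₂, hxt]; ring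
    rw [e]
    exact w₁.map_sub_le (w₁.map_add_le hX₁ hc₁) hx
  -- If `w D > 1`, then `F₁` has size at least `u^(-p-1)`, while `F₂` is at most `u^(-2)` for `w₁`;
  -- their sum could not be integral. Again `hc` excludes equality.
  have hDlt : w D < 1 := by
    by_contra h
    have hlt : 1 < w D := lt_of_le_of_ne (not_lt.1 h) fun h => by
      have := hc 1 ((p + 1) * (d - 1)) 0 one_ne_zero
      rw [pow_one, pow_zero, mul_comm, pow_mul, ← hwx, ← hwD] at this
      exact this h.symm
    have h1 : w (V ^ (p + 1)) ≤ w F₁ := by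
      rw [hF₁, map_mul, valuation_add_pow_sub_pow_of_lt w (by rwa [hY])
        (Nat.mul_ne_zero (by omega) (by omega))]
      exact le_mul_of_one_le_right zero_le (one_le_pow₀ hlt.le)
    have h2 := hmon _ _ h1
    rw [map_pow] at h2
    have h3 : w₁ F₂ ≤ w₁ V ^ 2 := by
      rw [hF₂, map_mul, map_pow]
      refine mul_le_of_le_one_right zero_le (w₁.map_sub_le ?_ ?_)
      · rw [map_pow]; exact pow_le_one₀ zero_le hy
      · rw [map_pow]; exact pow_le_one₀ zero_le hY₁.le
    have h4 : w₁ V ^ 2 < w₁ V ^ (p + 1) := pow_lt_pow_right₀ hV₁ (by omega)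
    rw [w₁.map_add_eq_of_lt_left (h3.trans_lt (h4.trans_le h2))] at hF
    exact absurd (h2.trans hF) (not_le.2 (one_lt_pow₀ hV₁ (by omega)))
  -- the two parts of the increment of `λ` have distinct values
  have hwF₁ : w F₁ = w V ^ (p + 1) * w D ^ p := by
    have hlt : w (D ^ p) < w (Y ^ p) := by
      rw [map_pow, map_pow, hY]
      exact pow_lt_pow_left₀ hDlt zero_le (by omega)
    have hn : ¬ p ∣ p - 1 := fun h => by have := Nat.le_of_dvd (by omega) h; omega
    rw [hF₁, map_mul, map_pow, pow_mul, pow_mul, add_pow_char,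
      valuation_add_pow_sub_pow w hlt (valuation_natCast p w hn), map_pow, map_pow, hY, one_pow,
      one_pow, one_mul]
  have hwF₂ : w F₂ = w V ^ 2 * w D := by
    have hn : ¬ p ∣ p * a + 1 := fun h => by
      have := (Nat.dvd_add_right (dvd_mul_right p a)).1 h
      have := Nat.le_of_dvd one_pos this
      omega
    rw [hF₂, map_mul, map_pow, valuation_add_pow_sub_pow w (by rwa [hY])
      (valuation_natCast p w hn), hY, one_pow, one_mul]
  -- Equal values would make `w(D)^(p-1)`, hence `w(c)^(p-1)` times a power of `w V`, a power of `w
  -- V`, which `hc` forbids as `p - 1 ≠ 0`.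
  have hne : w F₁ ≠ w F₂ := by
    intro h
    have hp1 : w D ^ p = w D ^ (p - 1) * w D := by
      rw [← pow_succ]; congr 1; omega
    rw [hwF₁, hwF₂, hp1, ← mul_assoc] at h
    have h := mul_right_cancel₀ hD0 h
    refine hc (p - 1) ((p + 1) * (d - 1) * (p - 1) + (p + 1)) 2 (by omega) ?_
    rw [← h, hwD, hwx, mul_pow, pow_add, ← pow_mul, ← pow_mul,
      mul_assoc (p + 1)]
    rw [mul_comm, mul_comm (w V ^ ((p + 1) * ((d - 1) * (p - 1)))), mul_assoc]
  have hF₂1 : w₁ F₂ ≤ 1 := by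
    refine le_trans (hmon _ _ ?_) hF
    rw [w.map_add_of_distinct_val hne]
    exact le_max_right _ _
  have hF₂e : w₁ F₂ = w₁ V ^ 2 * w₁ D := by
    rw [← map_pow, ← map_mul]
    exact hmon' _ _ (by rw [hwF₂, map_mul, map_pow])
  rw [hF₂e, hwD₁, hwx₁, ← pow_mul] at hF₂1
  have hUVk : ∀ k : ℕ, w₁ U ^ k * w₁ V ^ k = 1 := fun k => by rw [← mul_pow, hr₁, one_pow]
  -- Integrality of `u^(-2) D` gives the exponent `b + 1`, one better than `b`; this makes the
  -- conclusion strict.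
  calc w₁ c = w₁ U ^ ((p + 1) * (d - 1) + 2) *
        (w₁ V ^ 2 * (w₁ V ^ ((p + 1) * (d - 1)) * w₁ c)) := by
        rw [pow_add]
        calc w₁ c = (w₁ U ^ ((p + 1) * (d - 1)) * w₁ V ^ ((p + 1) * (d - 1))) *
              (w₁ U ^ 2 * w₁ V ^ 2) * w₁ c := by rw [hUVk, hUVk, one_mul, one_mul]
          _ = _ := by ac_rfl
    _ ≤ w₁ U ^ ((p + 1) * (d - 1) + 2) := mul_le_of_le_one_right zero_le hF₂1
    _ < _ := pow_lt_pow_right_of_lt_one₀ hU₁0 hU (Nat.lt_succ_self _)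

end KeyEstimate

/-! ### A radius infinitesimally larger than `1`, and specialization at `α`. -/

section Infinitesimal

universe v

variable {M : Type*} {Γ : Type v} [CommRing M] [LinearOrderedCommGroupWithZero Γ]

open LinearOrderedCommGroupWithZero in
/-- The Gauss valuation `w₁` of radius `1` is refined by the Gauss valuation `w` whose radius
is infinitesimally close to `1`; the values of `w` on polynomials without constant term are
independent of the values on constants. -/
theorem exists_refined_gaussValuation (v : Valuation M Γ) (c : M[X]) (hc : c.coeff 0 = 0) :
    ∃ (Γ₂ : Type v) (_ : LinearOrderedCommGroupWithZero Γ₂) (w : Valuation M[X] Γ₂)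
      (w₁ : Valuation M[X] Γ), (∀ f g, w f ≤ w g → w₁ f ≤ w₁ g) ∧
      (∀ m n, v m = v n → w (C m) = w (C n)) ∧ (∀ m n, v m ≤ v n → w (C m) ≤ w (C n)) ∧
      (∀ m, v m ≠ 0 → ∀ n i j : ℕ, n ≠ 0 → w c ^ n * w (C m) ^ i ≠ w (C m) ^ j) ∧
      (∀ m, w₁ (C m) = v m) ∧ (∀ f : M[X], (∀ i, v (f.coeff i) ≤ 1) → w₁ f ≤ 1) ∧
      ∀ i, v (c.coeff i) ≤ w₁ c := by
  let β := WithZero (Multiplicative ℤ)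
  -- The new value group is lexicographic with `Γ` first, so `t` exceeds `1` but lies below every
  -- element of `Γ` greater than `1`. Projecting to `Γ` sends `t` to `1`, so `w₁` is the Gauss
  -- valuation of radius `1`.
  let q : β := WithZero.exp 1
  have hq : q ≠ 0 := WithZero.exp_ne_zero
  let t : WithZero (Γˣ ×ₗ βˣ) := inr Γ β q
  have hinl : ∀ x : Γ, fst Γ β (inl Γ β x) = x := fun x =>
    DFunLike.congr_fun (fst_comp_inl Γ β) x
  have hlex : ∀ (x : Γ) (y : β) (hx : x ≠ 0) (hy : y ≠ 0), inl Γ β x * inr Γ β y =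
      ((toLex (Units.mk0 _ hx, Units.mk0 _ hy) : Γˣ ×ₗ βˣ) : WithZero (Γˣ ×ₗ βˣ)) :=
    fun x y hx hy => inl_mul_inr_eq_coe_toLex hx hy
  have ht : t ≠ 0 := by
    have := hlex 1 q one_ne_zero hq
    rw [map_one, one_mul] at this
    change inr Γ β q ≠ 0
    rw [this]
    exact WithZero.coe_ne_zero
  have hft : fst Γ β t = 1 := by
    have := hlex 1 q one_ne_zero hq
    rw [map_one, one_mul] at this
    change fst Γ β (inr Γ β q) = 1
    rw [this]
    simp
  let w := gaussValuation (v.map (inl Γ β).toMonoidWithZeroHom (inl Γ β).monotone') ht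
  let w₁ := w.map (fst Γ β).toMonoidWithZeroHom (fst Γ β).monotone'
  have hwC : ∀ m, w (C m) = inl Γ β (v m) := fun m => gaussValuation_C _ ht m
  have hw₁ : ∀ f, w₁ f = fst Γ β (w f) := fun f => rfl
  have hterm : ∀ m i, fst Γ β (inl Γ β (v m) * t ^ i) = v m := fun m i => by
    rw [map_mul, map_pow, hft, one_pow, mul_one, hinl]
  have hval : ∀ f : M[X], ∃ i, w f = inl Γ β (v (f.coeff i)) * t ^ i :=
    fun f => exists_gaussFun_eq _ t f
  have hmono : ∀ f g, w f ≤ w g → w₁ f ≤ w₁ g := fun f g h => (fst Γ β).monotone' h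
  have heq : ∀ m n, v m = v n → w (C m) = w (C n) := fun m n h => by rw [hwC, hwC, h]
  have hle : ∀ m n, v m ≤ v n → w (C m) ≤ w (C n) := fun m n h => by
    rw [hwC, hwC]
    exact (inl Γ β).monotone' h
  refine ⟨WithZero (Γˣ ×ₗ βˣ), inferInstance, w, w₁, hmono, heq, hle, fun m hm n i j hn h => ?_,
    fun m => by rw [hw₁, hwC, hinl], fun f hf => ?_, fun i => ?_⟩
  · obtain ⟨k, hk⟩ := hval c
    have hm' : inl Γ β (v m) ≠ 0 := (_root_.map_ne_zero _).2 hm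
    have hck : v (c.coeff k) ≠ 0 := by
      intro h0
      rw [hk, h0, map_zero, zero_mul, zero_pow hn, zero_mul, hwC] at h
      exact pow_ne_zero _ hm' h.symm
    -- As `c` has no constant term, its value involves `t^k` with `k ≠ 0`; constants have trivial
    -- second component, and comparing second components gives the absurd `q^(k n) = 1`.
    have hk0 : k ≠ 0 := by
      rintro rfl
      rw [hc, map_zero] at hck
      exact hck rfl
    have h1 : inl Γ β (v (c.coeff k) ^ n * v m ^ i) * inr Γ β (q ^ (k * n)) =
        inl Γ β (v m ^ j) * inr Γ β 1 := by
      rw [hk, hwC] at h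
      rw [map_one, mul_one, map_pow (inl Γ β), ← h, map_mul, map_pow, map_pow, map_pow, mul_pow,
        pow_mul]
      change _ * _ * (t ^ k) ^ n = _
      rw [mul_assoc, mul_assoc, mul_comm ((t ^ k) ^ n)]
    rw [hlex _ _ (mul_ne_zero (pow_ne_zero _ hck) (pow_ne_zero _ hm)) (pow_ne_zero _ hq),
      hlex _ _ (pow_ne_zero _ hm) one_ne_zero] at h1
    have h2 := congrArg (fun x : Γˣ ×ₗ βˣ => ((ofLex x).2 : β)) (WithZero.coe_inj.1 h1)
    have h3 : q ^ (k * n) = 1 := h2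
    have h4 : (1 : β) < q := by
      rw [← WithZero.exp_zero]
      exact WithZero.exp_lt_exp.2 one_pos
    exact absurd h3 (one_lt_pow₀ h4 (Nat.mul_ne_zero hk0 hn)).ne'
  · obtain ⟨k, hk⟩ := hval f
    rw [hw₁, hk, hterm]
    exact hf k
  · rw [hw₁, ← hterm (c.coeff i) i]
    exact (fst Γ β).monotone'
      (le_gaussFun (v.map (inl Γ β).toMonoidWithZeroHom (inl Γ β).monotone') t c i)

/-- The key estimate applies in `M[T]`, where `T` is still free and no cancellation occurs. It
bounds every coefficient of `c`, and substituting `α` with `v α ≤ 1` preserves the bound. -/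
theorem valuation_eval_lt (p : ℕ) [Fact p.Prime] [CharP M p] (v : Valuation M Γ)
    {U V X Y xt α : M} {c : M[X]} {a d : ℕ} (hc : c.coeff 0 = 0) (hUV : U * V = 1)
    (hU : v U < 1) (hX : v X ≤ 1) (hY : v Y = 1) (hα : v α ≤ 1) (hd : ¬ p ∣ d)
    (hxt : xt = X + (V ^ (p + 1) * Y ^ (p * (p - 1)) + V ^ 2 * Y ^ (p * a + 1)))
    (hy : ∀ i, v ((C (Y + xt ^ d) - (C xt + c) ^ d).coeff i) ≤ 1)
    (hx : ∀ i, v ((C xt + c - (C V ^ (p + 1) * (C (Y + xt ^ d) - (C xt + c) ^ d) ^ (p * (p - 1)) +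
      C V ^ 2 * (C (Y + xt ^ d) - (C xt + c) ^ d) ^ (p * a + 1))).coeff i) ≤ 1) :
    v (c.eval α) < v U ^ ((p + 1) * (d - 1) + 1) := by
  obtain ⟨Γ₂, _, w, w₁, hmon, heq, hle, hgen, hw₁, hint, hcoeff⟩ := exists_refined_gaussValuation v c hc
  have hV : v V ≠ 0 := by
    have h := congrArg v hUV
    rw [map_mul, map_one] at h
    exact right_ne_zero_of_mul_eq_one h
  have hUpos : 0 < v U := by
    have h := congrArg v hUV
    rw [map_mul, map_one] at h
    exact zero_lt_iff.2 (left_ne_zero_of_mul_eq_one h)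
  have h1 : w (C 1) = 1 := by rw [C_1, map_one]
  have key := valuation_lt_of_integral p w w₁ hmon (U := C U) (V := C V) (X := C X) (Y := C Y)
    (c := c) (xt := C xt) (a := a) (d := d) (by rw [← C_mul, hUV, C_1]) (by rwa [hw₁])
    ((hle X 1 (by rwa [map_one])).trans_eq h1)
    ((heq Y 1 (by rwa [map_one])).trans h1) hd (by rw [hxt]; simp) (hgen V hV)
    (by
      have := hint _ hy
      rwa [C_add, C_pow] at this)
    (by
      have := hint _ hx
      rwa [C_add, C_pow] at this)
  rw [hw₁] at key
  rw [eval_eq_sum_range]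
  refine v.map_sum_lt (pow_pos hUpos _).ne' fun i _ => ?_
  rw [map_mul, map_pow]
  exact lt_of_le_of_lt (mul_le_of_le_one_right zero_le (pow_le_one₀ zero_le hα))
    ((hcoeff i).trans_lt key)

end Infinitesimal

/-! ### General facts on `G_a`-actions and their invariants. -/

section GaActionTheory

variable {B : Type*} [CommRing B]

theorem mem_invariants {E : B →+* B[X]} {b : B} : b ∈ invariants E ↔ E b = C b := Iff.rfl

theorem evalAt_apply (E : B →+* B[X]) (a b : B) : evalAt E a b = (E b).eval a := rfl

theorem evalAt_of_mem {E : B →+* B[X]} (a : B) {b : B} (hb : b ∈ invariants E) :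
    evalAt E a b = b := by
  rw [evalAt_apply, mem_invariants.1 hb, eval_C]

/-- The axioms of a `G_a`-action may be checked on generators. -/
theorem isGaAction_of_adjoin {K : Type*} [CommRing K] [Algebra K B] (E : B →+* B[X])
    (hK : ∀ r : K, algebraMap K B r ∈ invariants E) {s : Set B} (hs : Algebra.adjoin K s = ⊤)
    (h : ∀ b ∈ s, (E b).eval 0 = b ∧ (E b).map E =
      (E b).eval₂ ((C : B[X] →+* B[X][X]).comp (C : B →+* B[X])) (C X + X)) : IsGaAction E := by
  have key : ∀ b : B, (E b).eval 0 = b ∧ (E b).map E =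
      (E b).eval₂ ((C : B[X] →+* B[X][X]).comp (C : B →+* B[X])) (C X + X) := by
    intro b
    have hb : b ∈ Algebra.adjoin K s := hs ▸ Algebra.mem_top
    induction hb using Algebra.adjoin_induction with
    | mem b hb => exact h b hb
    | algebraMap r =>
      rw [mem_invariants.1 (hK r)]
      refine ⟨by simp, ?_⟩
      simp only [map_C, eval₂_C, RingHom.comp_apply, mem_invariants.1 (hK r)]
    | add x y _ _ hx hy =>
      rw [map_add, eval_add, hx.1, hy.1, Polynomial.map_add, hx.2, hy.2, eval₂_add]
      exact ⟨rfl, rfl⟩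
    | mul x y _ _ hx hy =>
      rw [map_mul, eval_mul, hx.1, hy.1, Polynomial.map_mul, hx.2, hy.2, eval₂_mul]
      exact ⟨rfl, rfl⟩
  exact ⟨fun b => (key b).1, fun b => (key b).2⟩

/-- A homomorphism that translates generators by invariants is a `G_a`-action. -/
theorem isGaAction_of_translation {K : Type*} [CommRing K] [Algebra K B] (E : B →+* B[X])
    (hK : ∀ r : K, algebraMap K B r ∈ invariants E) {s : Set B} (hs : Algebra.adjoin K s = ⊤)
    (h : ∀ b ∈ s, ∃ f ∈ invariants E, E b = C b + C f * X) : IsGaAction E := by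
  refine isGaAction_of_adjoin E hK hs fun b hb => ?_
  obtain ⟨f, hf, hbf⟩ := h b hb
  rw [mem_invariants] at hf
  rw [hbf]
  refine ⟨by simp, ?_⟩
  simp only [Polynomial.map_add, Polynomial.map_mul, map_C, map_X, hbf, hf, eval₂_add,
    eval₂_mul, eval₂_C, eval₂_X, RingHom.comp_apply, C_add, C_mul]
  ring

/-- The axioms of a `G_a`-action hold on the image of an equivariant homomorphism. -/
theorem IsGaAction.axioms_map {B' : Type*} [CommRing B'] {E : B →+* B[X]} (hE : IsGaAction E)
    {E' : B' →+* B'[X]} {f : B →+* B'} (hf : ∀ b, E' (f b) = (E b).map f) (b : B) :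
    (E' (f b)).eval 0 = f b ∧ (E' (f b)).map E' =
      (E' (f b)).eval₂ ((C : B'[X] →+* B'[X][X]).comp (C : B' →+* B'[X])) (C X + X) := by
  refine ⟨?_, ?_⟩
  · rw [hf, eval_map, ← f.map_zero, eval₂_at_apply, hE.counit]
  · have h1 : E'.comp f = (mapRingHom f).comp E := RingHom.ext hf
    rw [hf, map_map, h1, ← map_map, hE.coassoc, ← coe_mapRingHom (mapRingHom f), hom_eval₂,
      eval₂_map]
    congr 1
    · ext r : 1
      simp
    · simp

theorem mem_invariants_map {B' : Type*} [CommRing B'] {E : B →+* B[X]}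
    {E' : B' →+* B'[X]} {f : B →+* B'} (hf : ∀ b, E' (f b) = (E b).map f) {b : B}
    (hb : b ∈ invariants E) : f b ∈ invariants E' := by
  rw [mem_invariants, hf, mem_invariants.1 hb, map_C]

theorem evalAt_map {B' : Type*} [CommRing B'] {E : B →+* B[X]}
    {E' : B' →+* B'[X]} {f : B →+* B'} (hf : ∀ b, E' (f b) = (E b).map f) (a b : B) :
    evalAt E' (f a) (f b) = f (evalAt E a b) := by
  rw [evalAt_apply, hf, eval_map, eval₂_at_apply, evalAt_apply]

theorem IsGaAction.injective {E : B →+* B[X]} (hE : IsGaAction E) : Function.Injective E :=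
  fun a b h => by rw [← hE.counit a, h, hE.counit]

/-- The leading coefficient of `E b` is invariant. -/
theorem IsGaAction.leadingCoeff_mem {E : B →+* B[X]} (hE : IsGaAction E) (b : B) :
    (E b).leadingCoeff ∈ invariants E := by
  nontriviality B
  -- Compare coefficients of `T₂^n`, with `n` the degree of `E b`: the left gives `E(b_n)`, and the
  -- right gives `b_n`, because `(T₁ + T₂)^n` is monic in `T₂`.
  have h := congrArg (fun P : B[X][X] => P.coeff (E b).natDegree) (hE.coassoc b)
  simp only [coeff_map] at h
  rw [mem_invariants, leadingCoeff, h, eval₂_eq_sum_range, finsetSum_coeff,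
    Finset.sum_range_succ, Finset.sum_eq_zero]
  · have hm : ((C X + X : B[X][X]) ^ (E b).natDegree).coeff (E b).natDegree = 1 := by
      have h1 : (C X + X : B[X][X]).Monic := by rw [add_comm]; exact monic_X_add_C _
      have h2 := (h1.pow (E b).natDegree).coeff_natDegree
      rw [h1.natDegree_pow, add_comm, natDegree_X_add_C, mul_one] at h2
      rwa [add_comm]
    rw [zero_add, RingHom.comp_apply, coeff_C_mul, hm, mul_one]
  · intro i hi
    rw [RingHom.comp_apply, coeff_C_mul,
      coeff_eq_zero_of_natDegree_lt (p := (C X + X : B[X][X]) ^ i), mul_zero]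
    refine lt_of_le_of_lt (natDegree_pow_le) ?_
    rw [add_comm, natDegree_X_add_C, mul_one]
    exact Finset.mem_range.1 hi

theorem IsGaAction.mem_of_natDegree {E : B →+* B[X]} (hE : IsGaAction E) {b : B}
    (h : (E b).natDegree = 0) : b ∈ invariants E := by
  rw [mem_invariants]
  have h1 := eq_C_of_natDegree_eq_zero h
  have h2 := hE.counit b
  rw [h1, eval_C] at h2
  rwa [h2] at h1

/-- The ring of invariants is factorially closed. -/
theorem IsGaAction.mem_of_mul_mem [IsDomain B] {E : B →+* B[X]} (hE : IsGaAction E) {a b : B}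
    (h : a * b ∈ invariants E) (h0 : a * b ≠ 0) : a ∈ invariants E := by
  have ha : E a ≠ 0 := (map_ne_zero_iff _ hE.injective).2 (left_ne_zero_of_mul h0)
  have hb : E b ≠ 0 := (map_ne_zero_iff _ hE.injective).2 (right_ne_zero_of_mul h0)
  have hd := congrArg natDegree (mem_invariants.1 h)
  rw [map_mul, natDegree_mul ha hb, natDegree_C] at hd
  exact hE.mem_of_natDegree (Nat.eq_zero_of_add_eq_zero_right hd)

/-- An element that generates a stable ideal is invariant. -/
theorem IsGaAction.mem_of_dvd_coeff [IsDomain B] {E : B →+* B[X]} (hE : IsGaAction E) {f : B}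
    (h : ∀ i, f ∣ (E f).coeff i) : f ∈ invariants E := by
  rcases eq_or_ne f 0 with rfl | hf
  · exact zero_mem _
  obtain ⟨g, hg⟩ := h (E f).natDegree
  have h0 : (E f).leadingCoeff ≠ 0 :=
    leadingCoeff_ne_zero.2 ((map_ne_zero_iff _ hE.injective).2 hf)
  have hm := hE.leadingCoeff_mem f
  rw [leadingCoeff, hg] at hm h0
  exact hE.mem_of_mul_mem hm h0

/-- The automorphism `E_α` commutes with the action. -/
theorem IsGaAction.apply_evalAt {E : B →+* B[X]} (hE : IsGaAction E) {α : B}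
    (hα : α ∈ invariants E) (b : B) : E (evalAt E α b) = (E b).map (evalAt E α) := by
  -- Setting `T₂ = α` or `T₁ = α` in coassociativity gives the two sides; `∑ b_i (T₁ + T₂)^i` is
  -- symmetric, so both agree.
  have h1 := congrArg (eval (C α)) (hE.coassoc b)
  have h2 := congrArg (map (evalRingHom α)) (hE.coassoc b)
  rw [map_map] at h2
  have e1 : E (evalAt E α b) = eval (C α) ((E b).map E) := by
    rw [eval_map, evalAt_apply, eval, hom_eval₂, RingHom.comp_id, mem_invariants.1 hα]
  have e2 : eval (C α) ((E b).eval₂ ((C : B[X] →+* B[X][X]).comp (C : B →+* B[X])) (C X + X)) =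
      map (evalRingHom α)
        ((E b).eval₂ ((C : B[X] →+* B[X][X]).comp (C : B →+* B[X])) (C X + X)) := by
    rw [← coe_evalRingHom, ← coe_mapRingHom, hom_eval₂, hom_eval₂]
    congr 1
    · ext r : 1
      simp
    · simp [add_comm]
  change _ = (E b).map ((evalRingHom α).comp E)
  rw [e1, h1, e2, ← h2]

/-- If all differences `E_α b - b` are divisible by `f = E_α x - x`, then `f` is invariant. -/
theorem IsGaAction.difference_mem [IsDomain B] {E : B →+* B[X]} (hE : IsGaAction E) {α x f : B}
    (hα : α ∈ invariants E) (hf : evalAt E α x = x + f)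
    (h : ∀ b, f ∣ evalAt E α b - b) : f ∈ invariants E := by
  refine hE.mem_of_dvd_coeff fun i => ?_
  have h1 : E f = (E x).map (evalAt E α) - E x := by
    rw [← hE.apply_evalAt hα, hf, map_add, add_sub_cancel_left]
  rw [h1, coeff_sub, coeff_map]
  exact h _

end GaActionTheory

/-! ### A criterion for stability. -/

section Stability

theorem algEquivAevalXAddC_eq_comp {A : Type*} [CommRing A] (f : A) (b : A[X]) :
    algEquivAevalXAddC f b = b.comp (X + C f) := by
  simp [algEquivAevalXAddC, comp, aeval_def]

variable {S : Type*} [CommRing S] [IsDomain S]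

/-- Here `E b` is `b` with `E X` substituted, so its degree in `T` is `deg b · deg (E X)`. By the
counit axiom `deg (E X) = 0` would make `X` invariant. -/
theorem invariants_eq_range {E : S[X] →+* S[X][X]} (h0 : ∀ b, (E b).eval 0 = b)
    (hS : ∀ s : S, C s ∈ invariants E) (hne : E X ≠ C X) :
    invariants E = (C : S →+* S[X]).range := by
  ext b
  refine ⟨fun hb => ?_, fun ⟨s, hs⟩ => hs ▸ hS s⟩
  have hE : E = eval₂RingHom ((C : S[X] →+* S[X][X]).comp (C : S →+* S[X])) (E X) := by
    apply Polynomial.ringHom_ext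
    · intro s
      rw [coe_eval₂RingHom, eval₂_C, mem_invariants.1 (hS s), RingHom.comp_apply]
    · rw [coe_eval₂RingHom, eval₂_X]
  have hEb : E b = (b.map (C : S →+* S[X])).comp (E X) := by
    conv_lhs => rw [hE]
    rw [coe_eval₂RingHom, comp, eval₂_map]
  have hd := congrArg natDegree (mem_invariants.1 hb)
  rw [hEb, natDegree_comp, natDegree_map_eq_of_injective C_injective, natDegree_C,
    mul_eq_zero] at hd
  rcases hd with hd | hd
  · exact ⟨b.coeff 0, (eq_C_of_natDegree_eq_zero hd).symm⟩
  · have h1 := eq_C_of_natDegree_eq_zero hd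
    have h2 := h0 X
    rw [h1, eval_C] at h2
    rw [h2] at h1
    exact absurd h1 hne

/-- If the ring is generated by factors of `f - κ` for a constant `κ`, then it is `f`-stable. -/
theorem isStable_of_factors {K : Type*} [CommRing K] [Algebra K S] {f : S} (hf : f ≠ 0) {κ : K}
    (hκ : f - algebraMap K S κ ≠ 0) {s : Set S} (hs : Algebra.adjoin K s = ⊤)
    (hfac : ∀ a ∈ s, a ∣ f - algebraMap K S κ) : IsStable K S f := by
  have hap : ∀ b : S[X], ((algEquivAevalXAddC f).restrictScalars K) b = b.comp (X + C f) :=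
    fun b => algEquivAevalXAddC_eq_comp f b
  refine Set.eq_singleton_iff_unique_mem.2 ⟨?_, ?_⟩
  · let E : S[X] →+* S[X][X] :=
      eval₂RingHom ((C : S[X] →+* S[X][X]).comp (C : S →+* S[X])) (C X + C (C f) * X)
    have hEC : ∀ a : S, C a ∈ invariants E := fun a => by
      rw [mem_invariants]
      change eval₂ _ _ (C a) = _
      rw [eval₂_C, RingHom.comp_apply]
    have hEX : E X = C X + C (C f) * X := eval₂_X _ _
    have hE : IsGaAction E := by
      refine isGaAction_of_translation (K := S) E hEC (s := {X}) adjoin_X ?_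
      rintro _ rfl
      exact ⟨C f, hEC f, hEX⟩
    refine ⟨E, ⟨hE, fun r => ?_⟩, ⟨1, one_mem _, fun b => ?_⟩, ?_⟩
    · rw [IsScalarTower.algebraMap_apply K S S[X]]
      exact hEC _
    · rw [hap]
      have : evalAt E 1 = compRingHom (X + C f) := by
        apply Polynomial.ringHom_ext
        · intro a
          rw [evalAt_of_mem 1 (hEC a)]
          simp
        · rw [evalAt_apply, hEX]
          simp
      rw [this]
      rfl
    · refine invariants_eq_range hE.counit hEC fun h => hf ?_
      rw [hEX, add_eq_left, ← C_0] at h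
      have := congrArg (fun P : S[X][X] => (P.coeff 1).coeff 0) h
      simpa using this
  · rintro A ⟨E, ⟨hE, hEK⟩, ⟨α, hα, hαε⟩, rfl⟩
    -- `difference_mem` applies because `f` divides `b(X + f) - b(X)` for every `b`.
    have hfmem : C f ∈ invariants E := by
      refine hE.difference_mem hα (x := X) ?_ fun b => ?_
      · rw [hαε, hap, X_comp]
      · rw [hαε, hap]
        have := sub_dvd_eval_sub (X + C f) X (b.map (C : S →+* S[X]))
        rwa [add_sub_cancel_left, eval_map, eval_map, eval₂_C_X] at this
    have hEK' : ∀ r : K, C (algebraMap K S r) ∈ invariants E := hEK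
    have hmem : C (f - algebraMap K S κ) ∈ invariants E := by
      rw [C_sub]
      exact sub_mem hfmem (hEK' κ)
    have hS : ∀ a : S, C a ∈ invariants E := by
      intro a
      have ha : a ∈ Algebra.adjoin K s := hs ▸ Algebra.mem_top
      induction ha using Algebra.adjoin_induction with
      | mem a ha =>
        obtain ⟨q, hq⟩ := hfac a ha
        rw [hq, C_mul] at hmem
        refine hE.mem_of_mul_mem hmem ?_
        rwa [← C_mul, Ne, C_eq_zero, ← hq]
      | algebraMap r => exact hEK' r
      | add x y _ _ hx hy => rw [C_add]; exact add_mem hx hy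
      | mul x y _ _ hx hy => rw [C_mul]; exact mul_mem hx hy
    refine invariants_eq_range hE.counit hS fun h => hf ?_
    have h1 := hαε X
    rw [hap, X_comp, evalAt_of_mem α h, left_eq_add, C_eq_zero] at h1
    exact h1

end Stability

/-! ### The action `E^g` in the coordinates `x̃, ỹ, z`. -/

section Coordinates

variable {R : Type*} [CommRing R] {K : Type*} [Field K] [Algebra R K]
variable (p l d : ℕ) (u : R)

theorem adjoin_coords :
    Algebra.adjoin K (Set.range (coords K p l d u)) = ⊤ := by
  rw [Algebra.adjoin_range_eq_range_aeval, AlgHom.range_eq_top]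
  exact (coordEquiv K p l d u).surjective

theorem X_one_eq : (MvPolynomial.X 1 : MvPolynomial (Fin (l + 2)) K) =
    yt K p l d u - xt K p l d u ^ d := by
  rw [yt, add_sub_cancel_right]

theorem X_zero_eq : (MvPolynomial.X 0 : MvPolynomial (Fin (l + 2)) K) =
    xt K p l d u - (MvPolynomial.C (algebraMap R K u)⁻¹ ^ (p + 1) *
      MvPolynomial.X 1 ^ (p * (p - 1)) + MvPolynomial.C (algebraMap R K u)⁻¹ ^ 2 *
      MvPolynomial.X 1 ^ (p * expA p d + 1)) := by
  rw [xt, lam, map_pow, map_pow, add_sub_cancel_right]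

theorem cst_mul_inv (hu : algebraMap R K u ≠ 0) :
    cst K l u * MvPolynomial.C (algebraMap R K u)⁻¹ = 1 := by
  rw [cst, ← map_mul, mul_inv_cancel₀ hu, map_one]

theorem cst_mem_invRing : cst K l u ∈ invRing K p l d u :=
  Subalgebra.algebraMap_mem _ (algebraMap R K u)

theorem yt_mem_invRing : yt K p l d u ∈ invRing K p l d u :=
  Algebra.subset_adjoin (Set.mem_insert _ _)

theorem z_mem_invRing (i : Fin l) : z K l i ∈ invRing K p l d u :=
  Algebra.subset_adjoin (Set.mem_insert_of_mem _ ⟨i, rfl⟩)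

/-- The translation amount `u^b (1 + u g)`. -/
def shift (g : MvPolynomial (Fin (l + 2)) K) : MvPolynomial (Fin (l + 2)) K :=
  cst K l u ^ expB p d * (1 + cst K l u * g)

variable (g : MvPolynomial (Fin (l + 2)) K)

theorem actionE_xt : actionE K p l d u g (xt K p l d u) =
    C (xt K p l d u) + C (shift p l d u g) * X := by
  rw [← coords_zero, ← coordEquiv_X, actionE, twoLine_apply, Fin.cons_zero, coordEquiv_X]
  rfl

theorem actionE_yt : actionE K p l d u g (yt K p l d u) = C (yt K p l d u) := by
  rw [← coords_one, ← coordEquiv_X, actionE, twoLine_apply, coordEquiv_X]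
  rfl

theorem actionE_z (i : Fin l) : actionE K p l d u g (z K l i) = C (z K l i) := by
  have h : z K l i = coordEquiv K p l d u (MvPolynomial.X i.succ.succ) := by
    rw [coordEquiv_X]; rfl
  rw [h, actionE, twoLine_apply, ← h]
  rfl

theorem actionE_of_mem {s : MvPolynomial (Fin (l + 2)) K} (hs : s ∈ invRing K p l d u) :
    actionE K p l d u g s = C s := by
  induction hs using Algebra.adjoin_induction with
  | mem b hb =>
    rcases hb with rfl | ⟨i, rfl⟩
    · exact actionE_yt p l d u g
    · exact actionE_z p l d u g i
  | algebraMap r => exact AlgHom.commutes _ r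
  | add x y _ _ hx hy => rw [map_add, hx, hy, C_add]
  | mul x y _ _ hx hy => rw [map_mul, hx, hy, C_mul]

variable {g}

theorem shift_mem (hg : g ∈ gRing K p l d u) : shift p l d u g ∈ invRing K p l d u :=
  mul_mem (pow_mem (cst_mem_invRing p l d u) _) (one_add_mem K p l d u hg)

theorem isGaActionOver_actionE (hg : g ∈ gRing K p l d u) :
    IsGaActionOver K (actionE K p l d u g).toRingHom := by
  have hK : ∀ r : K, algebraMap K (MvPolynomial (Fin (l + 2)) K) r ∈
      invariants (actionE K p l d u g).toRingHom := fun r =>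
    (actionE K p l d u g).commutes r
  refine ⟨isGaAction_of_translation _ hK (adjoin_coords p l d u) ?_, hK⟩
  rintro _ ⟨i, rfl⟩
  refine Fin.cases ?_ (fun i => Fin.cases ?_ (fun i => ?_) i) i
  · exact ⟨shift p l d u g, actionE_of_mem p l d u g (shift_mem p l d u hg),
      actionE_xt p l d u g⟩
  · refine ⟨0, zero_mem _, ?_⟩
    rw [C_0, zero_mul, add_zero]
    exact actionE_yt p l d u g
  · refine ⟨0, zero_mem _, ?_⟩
    rw [C_0, zero_mul, add_zero]
    exact actionE_z p l d u g i

variable (g) in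
/-- The automorphism `E^g_1`, as an endomorphism over `K`. -/
def actionOne : MvPolynomial (Fin (l + 2)) K →ₐ[K] MvPolynomial (Fin (l + 2)) K where
  __ := evalAt (actionE K p l d u g).toRingHom 1
  commutes' r := evalAt_of_mem 1 ((actionE K p l d u g).commutes r)

variable (g) in
theorem actionOne_xt : actionOne p l d u g (xt K p l d u) = xt K p l d u + shift p l d u g := by
  change eval 1 (actionE K p l d u g (xt K p l d u)) = _
  rw [actionE_xt]
  simp

variable (g) in
theorem actionOne_of_mem {s : MvPolynomial (Fin (l + 2)) K} (hs : s ∈ invRing K p l d u) :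
    actionOne p l d u g s = s := by
  change eval 1 (actionE K p l d u g s) = _
  rw [actionE_of_mem p l d u g hs, eval_C]

theorem actionOne_iterate_xt (hg : g ∈ gRing K p l d u) (n : ℕ) :
    (actionOne p l d u g)^[n] (xt K p l d u) = xt K p l d u + n * shift p l d u g := by
  induction n with
  | zero => simp
  | succ n ih =>
    rw [Function.iterate_succ_apply', ih, map_add, actionOne_xt, map_mul, map_natCast,
      actionOne_of_mem p l d u g (shift_mem p l d u hg)]
    push_cast
    ring

theorem actionOne_iterate_prime [Fact p.Prime] [CharP K p] (hg : g ∈ gRing K p l d u)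
    (b : MvPolynomial (Fin (l + 2)) K) : (actionOne p l d u g)^[p] b = b := by
  have h : ∀ n : ℕ, ⇑(actionOne p l d u g ^ n) = (actionOne p l d u g)^[n] := fun n =>
    AlgHom.coe_pow _ n
  have hfix : ∀ s ∈ invRing K p l d u, ∀ n : ℕ, (actionOne p l d u g)^[n] s = s := fun s hs n =>
    Function.iterate_fixed (actionOne_of_mem p l d u g hs) n
  have key : actionOne p l d u g ^ p = AlgHom.id K _ := by
    refine AlgHom.ext_of_adjoin_eq_top (adjoin_coords p l d u) ?_
    rintro _ ⟨i, rfl⟩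
    rw [h, AlgHom.id_apply]
    refine Fin.cases ?_ (fun i => Fin.cases ?_ (fun i => ?_) i) i
    · rw [coords_zero, actionOne_iterate_xt p l d u hg, CharP.cast_eq_zero, zero_mul, add_zero]
    · exact hfix _ (yt_mem_invRing p l d u) _
    · exact hfix _ (z_mem_invRing p l d u i) _
  rw [← h, key, AlgHom.id_apply]

end Coordinates

/-! ### Transport of stability to `K[x, y, z]`. -/

section Transport

variable {R : Type*} [CommRing R] {K : Type*} [Field K] [Algebra R K]
variable (p l d : ℕ) (u : R)

/-- Over `K`, the variable `u^(-b) x̃` is moved by `E^g_1` to itself plus `1 + u g`; so this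
identification turns `E^g_1` into the `ε` of the definition of stability. -/
theorem exists_equiv_polynomial_invRing (hu : algebraMap R K u ≠ 0) :
    ∃ θ : (invRing K p l d u)[X] ≃ₐ[K] MvPolynomial (Fin (l + 2)) K,
      (∀ s, θ (C s) = s) ∧ θ X =
        MvPolynomial.C (algebraMap R K u)⁻¹ ^ expB p d * xt K p l d u := by
  let f : (invRing K p l d u)[X] →ₐ[K] MvPolynomial (Fin (l + 2)) K :=
    Polynomial.eval₂AlgHom (invRing K p l d u).val
      (MvPolynomial.C (algebraMap R K u)⁻¹ ^ expB p d * xt K p l d u) fun _ => Commute.all _ _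
  have fC : ∀ s, f (C s) = s := fun s => eval₂_C _ _
  have fX : f X = MvPolynomial.C (algebraMap R K u)⁻¹ ^ expB p d * xt K p l d u := eval₂_X _ _
  let v : Fin (l + 2) → (invRing K p l d u)[X] :=
    Fin.cons (algebraMap K _ (algebraMap R K u ^ expB p d) * X)
      (Fin.cons (C ⟨yt K p l d u, yt_mem_invRing p l d u⟩)
        fun i => C ⟨z K l i, z_mem_invRing p l d u i⟩)
  let f' : MvPolynomial (Fin (l + 2)) K →ₐ[K] (invRing K p l d u)[X] :=
    twoLine (coordEquiv K p l d u) v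
  have hf' : ∀ i, f' (coords K p l d u i) = v i := fun i => by
    rw [← coordEquiv_X]
    exact twoLine_apply _ _ i
  have hinv : ∀ s (hs : s ∈ invRing K p l d u), f' s = C ⟨s, hs⟩ := by
    intro s hs
    induction hs using Algebra.adjoin_induction with
    | mem b hb =>
      rcases hb with rfl | ⟨i, rfl⟩
      · exact hf' 1
      · exact hf' i.succ.succ
    | algebraMap r => exact AlgHom.commutes f' r
    | add x y hx' hy' hx hy => rw [map_add, hx, hy, ← C_add]; rfl
    | mul x y hx' hy' hx hy => rw [map_mul, hx, hy, ← C_mul]; rfl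
  have h1 : f.comp f' = AlgHom.id K _ := by
    refine AlgHom.ext_of_adjoin_eq_top (adjoin_coords p l d u) ?_
    rintro _ ⟨i, rfl⟩
    rw [AlgHom.comp_apply, hf', AlgHom.id_apply]
    refine Fin.cases ?_ (fun i => Fin.cases ?_ (fun i => ?_) i) i
    · change f (algebraMap K _ (algebraMap R K u ^ expB p d) * X) = xt K p l d u
      rw [map_mul, AlgHom.commutes, fX, ← mul_assoc, map_pow, MvPolynomial.algebraMap_eq,
        ← mul_pow]
      change (cst K l u * _) ^ _ * _ = _
      rw [cst_mul_inv l u hu, one_pow, one_mul]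
    · exact fC _
    · exact fC _
  have h2 : f'.comp f = AlgHom.id K _ := by
    apply AlgHom.coe_ringHom_injective
    apply Polynomial.ringHom_ext
    · intro s
      change f' (f (C s)) = C s
      rw [fC, hinv _ s.2]
    · change f' (f X) = X
      rw [fX, map_mul, map_pow, ← MvPolynomial.algebraMap_eq, AlgHom.commutes]
      have : f' (xt K p l d u) = algebraMap K _ (algebraMap R K u ^ expB p d) * X := hf' 0
      rw [this, ← mul_assoc, ← map_pow, ← map_mul, ← mul_pow, inv_mul_cancel₀ hu, one_pow,
        map_one, one_mul]
  exact ⟨AlgEquiv.ofAlgHom f f' h1 h2, fC, fX⟩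

/-- If `K[ỹ, z]` is `(1 + u g)`-stable, then it is contained in the ring of invariants of each
action over `K` that has `E^g_1` as a member. -/
theorem yt_mem_invariants_of_isStable (hu : algebraMap R K u ≠ 0)
    {g : MvPolynomial (Fin (l + 2)) K} (hg : g ∈ gRing K p l d u)
    (hst : IsStable K (invRing K p l d u) ⟨1 + cst K l u * g, one_add_mem K p l d u hg⟩)
    {E : MvPolynomial (Fin (l + 2)) K →+* (MvPolynomial (Fin (l + 2)) K)[X]}
    (hE : IsGaActionOver K E) {α : MvPolynomial (Fin (l + 2)) K} (hα : α ∈ invariants E)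
    (hαE : ∀ b, evalAt E α b = actionOne p l d u g b) :
    yt K p l d u ∈ invariants E := by
  obtain ⟨θ, hθC, hθX⟩ := exists_equiv_polynomial_invRing (K := K) p l d u hu
  let E' : (invRing K p l d u)[X] →+* (invRing K p l d u)[X][X] :=
    (mapRingHom (θ.symm : MvPolynomial (Fin (l + 2)) K →+* (invRing K p l d u)[X])).comp
      (E.comp (θ : (invRing K p l d u)[X] →+* MvPolynomial (Fin (l + 2)) K))
  let ψ : MvPolynomial (Fin (l + 2)) K →+* (invRing K p l d u)[X] := θ.symm
  have hψ : ∀ b, E' (ψ b) = (E b).map ψ := fun b => by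
    change (E (θ (θ.symm b))).map ψ = _
    rw [AlgEquiv.apply_symm_apply]
  have hψθ : ∀ b, ψ (θ b) = b := fun b => θ.symm_apply_apply b
  have hψ' : ∀ b, θ (ψ b) = b := fun b => θ.apply_symm_apply b
  have hE' : IsGaActionOver (B := (invRing K p l d u)[X]) K E' := by
    refine ⟨⟨fun b => ?_, fun b => ?_⟩, fun r => ?_⟩
    · rw [← hψθ b]; exact (hE.1.axioms_map hψ (θ b)).1
    · rw [← hψθ b]; exact (hE.1.axioms_map hψ (θ b)).2
    · have := mem_invariants_map (B' := (invRing K p l d u)[X]) hψ (hE.2 r)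
      rwa [show ψ (algebraMap K _ r) = algebraMap K _ r from θ.symm.commutes r] at this
  have hmem : invariants E' ∈ invariantRings K
      ((algEquivAevalXAddC (⟨1 + cst K l u * g, one_add_mem K p l d u hg⟩ :
        invRing K p l d u)).restrictScalars K) := by
    refine ⟨E', hE', ⟨ψ α, mem_invariants_map (B' := (invRing K p l d u)[X]) hψ hα, fun b => ?_⟩, rfl⟩
    have hcomm : ((actionOne p l d u g).comp θ.toAlgHom) =
        θ.toAlgHom.comp ((algEquivAevalXAddC (⟨1 + cst K l u * g, one_add_mem K p l d u hg⟩ :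
          invRing K p l d u)).restrictScalars K).toAlgHom := by
      apply AlgHom.coe_ringHom_injective
      apply Polynomial.ringHom_ext
      · intro s
        change actionOne p l d u g (θ (C s)) = θ (algEquivAevalXAddC _ (C s))
        rw [algEquivAevalXAddC_eq_comp, C_comp, hθC, actionOne_of_mem p l d u g s.2]
      · change actionOne p l d u g (θ X) = θ (algEquivAevalXAddC _ X)
        rw [algEquivAevalXAddC_eq_comp, X_comp, map_add, hθC, hθX, map_mul, actionOne_xt,
          map_pow, ← MvPolynomial.algebraMap_eq, AlgHom.commutes, MvPolynomial.algebraMap_eq,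
          mul_add, shift, ← mul_assoc, ← mul_pow, mul_comm _ (cst K l u), cst_mul_inv l u hu,
          one_pow, one_mul]
    have h1 := DFunLike.congr_fun hcomm b
    change actionOne p l d u g (θ b) = θ (algEquivAevalXAddC _ b) at h1
    change _ = algEquivAevalXAddC _ b
    rw [← hψθ b, evalAt_map hψ, hψθ, hαE, h1, hψθ]
  rw [IsStable] at hst
  rw [hst, Set.mem_singleton_iff] at hmem
  have hy : (C ⟨yt K p l d u, yt_mem_invRing p l d u⟩ : (invRing K p l d u)[X]) ∈
      invariants (B := (invRing K p l d u)[X]) E' := by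
    rw [hmem]
    exact ⟨_, rfl⟩
  have hθE : ∀ b, E ((θ : (invRing K p l d u)[X] →+* MvPolynomial (Fin (l + 2)) K) b) =
      (E' b).map (θ : (invRing K p l d u)[X] →+* MvPolynomial (Fin (l + 2)) K) := fun b => by
    change E (θ b) = ((E (θ b)).map ψ).map _
    rw [map_map]
    have : (θ : (invRing K p l d u)[X] →+* MvPolynomial (Fin (l + 2)) K).comp ψ =
        RingHom.id _ := RingHom.ext hψ'
    rw [this, map_id]
  have := mem_invariants_map hθE hy
  rwa [show (θ : (invRing K p l d u)[X] →+* MvPolynomial (Fin (l + 2)) K)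
    (C ⟨yt K p l d u, yt_mem_invRing p l d u⟩) = yt K p l d u from hθC _] at this

end Transport

/-! ### The cancellation that makes `E^g_1` integral. -/

section Integrality

variable {A : Type*} [CommRing A] (p : ℕ) [Fact p.Prime] [CharP A p]

/-- This identity is the origin of `a`: the two sides are the exponents of `y` in `y^(p(p-2)) D^p`
and `y^(pa) D` for `D = y^(p(p-1)(d-1))`. -/
theorem expA_balance {p d : ℕ} (hp : 2 ≤ p) :
    p * (p - 2) + p * (p * (p - 1) * (d - 1)) = p * expA p d + p * (p - 1) * (d - 1) := by
  obtain ⟨q, rfl⟩ := Nat.exists_eq_add_of_le hp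
  have h1 : 2 + q - 2 = q := by omega
  have h2 : 2 + q - 1 = q + 1 := by omega
  rw [expA, h1, h2]
  ring

/-- With `N = u^{p+1} x̃` and `e = 1 + u g`, the image of `y` is `y + u D`, and the increment
of `λ` is integral. -/
theorem exists_integral_increments {U X Y g e N : A} {d : ℕ} (he : e = 1 + U * g)
    (hN : N = U ^ (p + 1) * X + (Y ^ (p * (p - 1)) + U ^ (p - 1) * Y ^ (p * expA p d + 1))) :
    ∃ D ξ : A, (N + U ^ ((p + 1) * d + 1) * e) ^ d = N ^ d - U ^ ((p + 1) * d + 1) * D ∧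
      ((Y + U * D) ^ (p * (p - 1)) - Y ^ (p * (p - 1))) +
        U ^ (p - 1) * ((Y + U * D) ^ (p * expA p d + 1) - Y ^ (p * expA p d + 1)) =
          U ^ (p + 1) * ξ := by
  have hp2 : 2 ≤ p := (Fact.out : p.Prime).two_le
  obtain ⟨k, hk⟩ := powAddExpansion N (U ^ ((p + 1) * d + 1) * e) d
  let D : A := -(d * N ^ (d - 1) * e + k * U ^ ((p + 1) * d + 1) * e ^ 2)
  -- Modulo `U` one has `N ≡ Y^(p(p-1))` and `e ≡ 1`, and the quadratic remainder vanishes.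
  have hD0 : U ∣ D - (-(d : A)) * Y ^ (p * (p - 1) * (d - 1)) := by
    have h1 : U ∣ N - Y ^ (p * (p - 1)) := by
      have : N - Y ^ (p * (p - 1)) = U * (U ^ p * X) + U ^ (p - 1) * Y ^ (p * expA p d + 1) := by
        rw [hN, pow_succ']; ring
      rw [this]
      exact dvd_add (dvd_mul_right _ _) (dvd_mul_of_dvd_left (dvd_pow_self _ (by omega)) _)
    have h2 : U ∣ N ^ (d - 1) - Y ^ (p * (p - 1) * (d - 1)) := by
      rw [pow_mul Y (p * (p - 1))]
      exact h1.trans (sub_dvd_pow_sub_pow _ _ _)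
    obtain ⟨r, hr⟩ := h2
    refine ⟨-(d * r) - (d * N ^ (d - 1) * g) - k * U ^ ((p + 1) * d) * e ^ 2, ?_⟩
    have hr' : N ^ (d - 1) = Y ^ (p * (p - 1) * (d - 1)) + U * r := by rw [← hr]; ring
    change -(d * N ^ (d - 1) * e + k * U ^ ((p + 1) * d + 1) * e ^ 2) - _ = _
    have he' : (d : A) * N ^ (d - 1) * e = d * (Y ^ (p * (p - 1) * (d - 1)) + U * r) +
        d * N ^ (d - 1) * (U * g) := by
      rw [← hr', he]; ring
    rw [he', pow_succ]
    ring
  have hkey : U ∣ -Y ^ (p * (p - 2)) * D ^ p + Y ^ (p * expA p d) * D := by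
    have h1 : U ∣ D ^ p - ((-(d : A)) * Y ^ (p * (p - 1) * (d - 1))) ^ p :=
      hD0.trans (sub_dvd_pow_sub_pow _ _ _)
    have hfrob : (-(d : A)) ^ p = -d := by
      have h := (frobenius A p).map_neg (d : A)
      rwa [map_natCast, frobenius_def] at h
    have h2 : -Y ^ (p * (p - 2)) * D ^ p + Y ^ (p * expA p d) * D =
        -Y ^ (p * (p - 2)) * (D ^ p - ((-(d : A)) * Y ^ (p * (p - 1) * (d - 1))) ^ p) +
          Y ^ (p * expA p d) * (D - (-(d : A)) * Y ^ (p * (p - 1) * (d - 1))) := by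
      have h3 : Y ^ (p * (p - 2)) * (Y ^ (p * (p - 1) * (d - 1))) ^ p =
          Y ^ (p * expA p d) * Y ^ (p * (p - 1) * (d - 1)) := by
        rw [← pow_mul, mul_comm (p * (p - 1) * (d - 1)) p, ← pow_add, ← pow_add,
          expA_balance hp2]
      rw [mul_pow, hfrob]
      linear_combination (d : A) * h3
    rw [h2]
    exact dvd_add (dvd_mul_of_dvd_right h1 _) (dvd_mul_of_dvd_right hD0 _)
  obtain ⟨s, hs⟩ := hkey
  obtain ⟨k₁, hk₁⟩ := powAddExpansion (Y ^ p) (U ^ p * D ^ p) (p - 1)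
  obtain ⟨k₂, hk₂⟩ := powAddExpansion Y (U * D) (p * expA p d + 1)
  have hp0 : (p : A) = 0 := CharP.cast_eq_zero A p
  have hcast : ((p - 1 : ℕ) : A) = -1 := by
    rw [Nat.cast_sub (by omega), hp0, Nat.cast_one, zero_sub]
  have hcast' : ((p * expA p d + 1 : ℕ) : A) = 1 := by
    rw [Nat.cast_add, Nat.cast_mul, hp0, zero_mul, Nat.cast_one, zero_add]
  -- The linear terms sum to `U^p · U s`; the quadratic ones carry `U^(2p)` and `U^(p-1) · U^2`.
  -- Dividing by `U^(p+1)` gives `ξ`.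
  refine ⟨D, s + k₁ * U ^ (p - 1) * D ^ (2 * p) + k₂ * D ^ 2, ?_, ?_⟩
  · rw [hk]
    change _ = _ - _ * -(d * N ^ (d - 1) * e + k * U ^ ((p + 1) * d + 1) * e ^ 2)
    ring
  · have e1 : (Y + U * D) ^ (p * (p - 1)) - Y ^ (p * (p - 1)) =
        -Y ^ (p * (p - 2)) * (U ^ p * D ^ p) + k₁ * (U ^ p * D ^ p) ^ 2 := by
      rw [pow_mul, add_pow_char, mul_pow, hk₁, hcast, pow_mul Y p (p - 1), pow_mul Y p (p - 2),
        show p - 1 - 1 = p - 2 by omega]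
      ring
    have e2 : (Y + U * D) ^ (p * expA p d + 1) - Y ^ (p * expA p d + 1) =
        Y ^ (p * expA p d) * (U * D) + k₂ * (U * D) ^ 2 := by
      rw [hk₂, hcast', Nat.add_sub_cancel]
      ring
    rw [e1, e2]
    have hU1 : U ^ p = U ^ (p - 1) * U := by rw [← pow_succ]; congr 1; omega
    have hU2 : U ^ (p + 1) = U ^ (p - 1) * U * U := by rw [pow_succ, hU1]
    rw [hU2, hU1]
    linear_combination U ^ (p - 1) * U * hs

end Integrality

/-! ### Restriction of `E^g_1`, but not of `E^g`, to `R[x, y, z]`. -/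

section Integral

variable {R : Type*} [CommRing R] {K : Type*} [Field K] [Algebra R K]
variable (p l d : ℕ) (u : R)

theorem map_X_eq (i : Fin (l + 2)) : MvPolynomial.map (algebraMap R K)
    (MvPolynomial.X i : MvPolynomial (Fin (l + 2)) R) = MvPolynomial.X i :=
  MvPolynomial.map_X _ _

theorem map_C_eq : MvPolynomial.map (algebraMap R K)
    (MvPolynomial.C u : MvPolynomial (Fin (l + 2)) R) = cst K l u :=
  MvPolynomial.map_C _ _

/-- The element `u^{p+1} x̃` of `R[x, y, z]`. -/
def numer : MvPolynomial (Fin (l + 2)) R :=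
  MvPolynomial.C u ^ (p + 1) * MvPolynomial.X 0 + (MvPolynomial.X 1 ^ (p * (p - 1)) +
    MvPolynomial.C u ^ (p - 1) * MvPolynomial.X 1 ^ (p * expA p d + 1))

theorem map_numer (hp : 1 ≤ p) (hu : algebraMap R K u ≠ 0) :
    MvPolynomial.map (algebraMap R K) (numer p l d u) =
      cst K l u ^ (p + 1) * xt K p l d u := by
  have h1 := cst_mul_inv (K := K) l u hu
  have h2 : cst K l u ^ (p + 1) * MvPolynomial.C (algebraMap R K u)⁻¹ ^ (p + 1) = 1 := by
    rw [← mul_pow, h1, one_pow]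
  have h3 : cst K l u ^ (p + 1) * MvPolynomial.C (algebraMap R K u)⁻¹ ^ 2 =
      cst K l u ^ (p - 1) := by
    have : p + 1 = (p - 1) + 2 := by omega
    rw [this, pow_add, mul_assoc, ← mul_pow, h1, one_pow, mul_one]
  simp only [numer, map_add, map_mul, map_pow, map_X_eq, map_C_eq, xt, lam]
  linear_combination (-(MvPolynomial.X 1 : MvPolynomial (Fin (l + 2)) K) ^ (p * (p - 1))) * h2 -
    (MvPolynomial.X 1 : MvPolynomial (Fin (l + 2)) K) ^ (p * expA p d + 1) * h3

theorem exists_map_eq_of_mem_gRing (hp : 1 ≤ p) (hu : algebraMap R K u ≠ 0)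
    {g : MvPolynomial (Fin (l + 2)) K} (hg : g ∈ gRing K p l d u) :
    ∃ g', MvPolynomial.map (algebraMap R K) g' = g := by
  induction hg using Algebra.adjoin_induction with
  | mem b hb =>
    rcases hb with rfl | ⟨i, rfl⟩
    -- The factor `u^((p+1)d)` clears the denominator of `x̃^d`.
    · refine ⟨MvPolynomial.C u ^ ((p + 1) * d) * MvPolynomial.X 1 + numer p l d u ^ d, ?_⟩
      rw [map_add, map_mul, map_pow, map_pow, map_numer p l d u hp hu, map_X_eq, map_C_eq, yt]
      ring
    · exact ⟨MvPolynomial.X i.succ.succ, map_X_eq l _⟩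
  | algebraMap r => exact ⟨MvPolynomial.C r, map_C_eq l r⟩
  | add x y _ _ hx hy =>
    obtain ⟨x', rfl⟩ := hx
    obtain ⟨y', rfl⟩ := hy
    exact ⟨x' + y', map_add _ _ _⟩
  | mul x y _ _ hx hy =>
    obtain ⟨x', rfl⟩ := hx
    obtain ⟨y', rfl⟩ := hy
    exact ⟨x' * y', map_mul _ _ _⟩

theorem map_injective_of_isFractionRing [IsDomain R] [IsFractionRing R K] (n : ℕ) :
    Function.Injective (MvPolynomial.map (σ := Fin n) (algebraMap R K)) :=
  MvPolynomial.map_injective _ (IsFractionRing.injective R K)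

theorem algebraMap_ne_zero_of_ne_zero [IsDomain R] [IsFractionRing R K] {u : R} (hu : u ≠ 0) :
    algebraMap R K u ≠ 0 :=
  (map_ne_zero_iff _ (IsFractionRing.injective R K)).2 hu

/-- If it vanished, its constant term would exhibit an inverse of `u` in `R`. -/
theorem one_add_ne_zero [IsDomain R] [IsFractionRing R K] (hp : 1 ≤ p) (hu0 : u ≠ 0)
    (hu : ¬ IsUnit u) {g : MvPolynomial (Fin (l + 2)) K} (hg : g ∈ gRing K p l d u) :
    1 + cst K l u * g ≠ 0 := by
  obtain ⟨g', rfl⟩ := exists_map_eq_of_mem_gRing p l d u hp (algebraMap_ne_zero_of_ne_zero hu0) hg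
  intro h
  rw [← map_C_eq, ← map_mul, ← map_one (MvPolynomial.map (algebraMap R K)), ← map_add,
    ← map_zero (MvPolynomial.map (algebraMap R K))] at h
  have h1 := congrArg MvPolynomial.constantCoeff (map_injective_of_isFractionRing (l + 2) h)
  rw [map_add, map_one, map_mul, MvPolynomial.constantCoeff_C, map_zero] at h1
  refine hu (IsUnit.of_mul_eq_one (-MvPolynomial.constantCoeff g') ?_)
  linear_combination -h1

theorem shift_ne_zero [IsDomain R] [IsFractionRing R K] (hp : 1 ≤ p) (hu0 : u ≠ 0)
    (hu : ¬ IsUnit u) {g : MvPolynomial (Fin (l + 2)) K} (hg : g ∈ gRing K p l d u) :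
    shift p l d u g ≠ 0 := by
  refine mul_ne_zero (pow_ne_zero _ ?_) (one_add_ne_zero p l d u hp hu0 hu hg)
  rw [cst, Ne, MvPolynomial.C_eq_zero]
  exact algebraMap_ne_zero_of_ne_zero hu0

/-- `E^g_1` maps `x` and `y` into `R[x, y, z]`. -/
theorem exists_map_eq_actionOne [Fact p.Prime] [CharP R p] (hu : algebraMap R K u ≠ 0)
    {g : MvPolynomial (Fin (l + 2)) K} (hg : g ∈ gRing K p l d u) (hd : d ≠ 0)
    (i : Fin (l + 2)) :
    ∃ q, MvPolynomial.map (algebraMap R K) q = actionOne p l d u g (MvPolynomial.X i) := by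
  have hp : 1 ≤ p := (Fact.out : p.Prime).one_le
  obtain ⟨g', hg'⟩ := exists_map_eq_of_mem_gRing p l d u hp hu hg
  obtain ⟨D, ξ, h1, h2⟩ := exists_integral_increments p (d := d)
    (U := (MvPolynomial.C u : MvPolynomial (Fin (l + 2)) R)) (X := MvPolynomial.X 0)
    (Y := MvPolynomial.X 1) (g := g') rfl (N := numer p l d u) rfl
  have hUV := cst_mul_inv (K := K) l u hu
  have hc : ∀ k : ℕ, cst K l u ^ k * MvPolynomial.C (algebraMap R K u)⁻¹ ^ k = 1 := fun k => by
    rw [← mul_pow, hUV, one_pow]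
  have h1' := congrArg (MvPolynomial.map (algebraMap R K)) h1
  have h2' := congrArg (MvPolynomial.map (algebraMap R K)) h2
  simp only [map_add, map_sub, map_mul, map_pow, map_one, map_X_eq, map_C_eq, hg',
    map_numer p l d u hp hu] at h1' h2'
  have hy : actionOne p l d u g (MvPolynomial.X 1) =
      MvPolynomial.X 1 + cst K l u * MvPolynomial.map (algebraMap R K) D := by
    have e1 : cst K l u ^ (p + 1) * xt K p l d u + cst K l u ^ ((p + 1) * d + 1) *
        (1 + cst K l u * g) = cst K l u ^ (p + 1) * (xt K p l d u + shift p l d u g) := by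
      have : (p + 1) * d + 1 = (p + 1) + expB p d := by
        obtain ⟨k, rfl⟩ := Nat.exists_eq_succ_of_ne_zero hd
        rw [expB, Nat.succ_sub_one, Nat.succ_eq_add_one]
        ring
      rw [this, shift, pow_add]
      ring
    rw [e1, mul_pow, mul_pow, ← pow_mul, pow_succ (cst K l u) ((p + 1) * d), mul_assoc,
      ← mul_sub] at h1'
    have h3 := mul_left_cancel₀ (left_ne_zero_of_mul_eq_one (hc _)) h1'
    rw [X_one_eq p l d u, map_sub, map_pow, actionOne_xt,
      actionOne_of_mem p l d u g (yt_mem_invRing p l d u), h3]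
    ring
  have hx : actionOne p l d u g (MvPolynomial.X 0) =
      MvPolynomial.X 0 + shift p l d u g - MvPolynomial.map (algebraMap R K) ξ := by
    have hV : ∀ k : K, actionOne p l d u g (MvPolynomial.C k) = MvPolynomial.C k :=
      fun k => (actionOne p l d u g).commutes k
    have e2 : MvPolynomial.C (algebraMap R K u)⁻¹ ^ (p + 1) * cst K l u ^ (p - 1) =
        MvPolynomial.C (algebraMap R K u)⁻¹ ^ 2 := by
      have : p + 1 = 2 + (p - 1) := by omega
      rw [this, pow_add, mul_assoc, ← mul_pow, mul_comm _ (cst K l u), hUV, one_pow, mul_one]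
    rw [X_zero_eq p l d u, map_sub, map_add, map_mul, map_mul, map_pow, map_pow, map_pow, map_pow,
      hV, actionOne_xt, hy]
    linear_combination (-MvPolynomial.C (algebraMap R K u)⁻¹ ^ (p + 1)) * h2' +
      ((MvPolynomial.X 1 + cst K l u * MvPolynomial.map (algebraMap R K) D) ^
        (p * expA p d + 1) - MvPolynomial.X 1 ^ (p * expA p d + 1)) * e2 +
      MvPolynomial.map (algebraMap R K) ξ * -hc (p + 1)
  refine Fin.cases ?_ (fun i => Fin.cases ?_ (fun i => ?_) i) i
  · refine ⟨MvPolynomial.X 0 +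
      MvPolynomial.C u ^ expB p d * (1 + MvPolynomial.C u * g') - ξ, ?_⟩
    rw [hx, map_sub, map_add, map_mul, map_pow, map_add, map_mul, map_one, map_X_eq, map_C_eq, hg']
    rfl
  · refine ⟨MvPolynomial.X 1 + MvPolynomial.C u * D, ?_⟩
    rw [map_add, map_mul, map_X_eq, map_C_eq]
    exact hy.symm
  · refine ⟨MvPolynomial.X i.succ.succ, ?_⟩
    rw [map_X_eq]
    exact (actionOne_of_mem p l d u g (z_mem_invRing p l d u i)).symm

/-- `E^g_1` restricts to an automorphism of `R[x, y, z]` of order `p`. -/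
theorem exists_restriction [IsDomain R] [IsFractionRing R K] [Fact p.Prime] [CharP R p]
    (hu0 : u ≠ 0) (hu : ¬ IsUnit u) {g : MvPolynomial (Fin (l + 2)) K}
    (hg : g ∈ gRing K p l d u) (hd : d ≠ 0) :
    ∃ σ : MvPolynomial (Fin (l + 2)) R ≃ₐ[R] MvPolynomial (Fin (l + 2)) R,
      IsRestriction K (evalAt (actionE K p l d u g).toRingHom 1) σ ∧ orderOf σ = p := by
  have hp : 1 ≤ p := (Fact.out : p.Prime).one_le
  have hu' : algebraMap R K u ≠ 0 := algebraMap_ne_zero_of_ne_zero hu0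
  have : CharP K p := charP_of_injective_algebraMap (IsFractionRing.injective R K) p
  have hinj := map_injective_of_isFractionRing (R := R) (K := K) (l + 2)
  choose q hq using exists_map_eq_actionOne p l d u hu' hg hd
  let f : MvPolynomial (Fin (l + 2)) R →ₐ[R] MvPolynomial (Fin (l + 2)) R := MvPolynomial.aeval q
  have hf : ∀ b, MvPolynomial.map (algebraMap R K) (f b) =
      actionOne p l d u g (MvPolynomial.map (algebraMap R K) b) := by
    have : (MvPolynomial.map (algebraMap R K)).comp f.toRingHom =
        (actionOne p l d u g).toRingHom.comp (MvPolynomial.map (algebraMap R K)) := by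
      apply MvPolynomial.ringHom_ext
      · intro r
        change MvPolynomial.map _ (f (algebraMap R _ r)) = actionOne p l d u g _
        rw [AlgHom.commutes, MvPolynomial.map_C]
        exact (MvPolynomial.map_C _ _).trans ((actionOne p l d u g).commutes _).symm
      · intro i
        change MvPolynomial.map _ (f (MvPolynomial.X i)) = actionOne p l d u g _
        rw [map_X_eq, ← hq, MvPolynomial.aeval_X]
    exact DFunLike.congr_fun this
  have hfn : ∀ (n : ℕ) b, MvPolynomial.map (algebraMap R K) (f^[n] b) =
      (actionOne p l d u g)^[n] (MvPolynomial.map (algebraMap R K) b) := fun n =>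
    (Function.Semiconj.iterate_right (f := MvPolynomial.map (algebraMap R K)) hf n)
  have hfp : f ^ p = 1 := by
    refine AlgHom.ext fun b => hinj ?_
    rw [AlgHom.coe_pow, hfn, actionOne_iterate_prime p l d u hg, AlgHom.one_apply]
  have hpp : p - 1 + 1 = p := by omega
  let σ : MvPolynomial (Fin (l + 2)) R ≃ₐ[R] MvPolynomial (Fin (l + 2)) R :=
    AlgEquiv.ofAlgHom f (f ^ (p - 1))
      (by change f * f ^ (p - 1) = 1; rw [← pow_succ', hpp, hfp])
      (by change f ^ (p - 1) * f = 1; rw [← pow_succ, hpp, hfp])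
  refine ⟨σ, hf, orderOf_eq_prime ?_ ?_⟩
  · refine AlgEquiv.ext fun b => ?_
    have h1 : ∀ n : ℕ, (σ ^ n) b = f^[n] b := by
      intro n
      induction n with
      | zero => rfl
      | succ n ih => rw [pow_succ', AlgEquiv.mul_apply, ih, Function.iterate_succ_apply']; rfl
    rw [h1, ← AlgHom.coe_pow, hfp]
    rfl
  · intro h
    have h1 : actionOne p l d u g = AlgHom.id K _ := by
      refine MvPolynomial.algHom_ext fun i => ?_
      rw [← hq, AlgHom.id_apply, ← map_X_eq (R := R)]
      congr 1
      have := DFunLike.congr_fun h (MvPolynomial.X i : MvPolynomial (Fin (l + 2)) R)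
      rw [← MvPolynomial.aeval_X (R := R) q i]
      exact this
    have h2 := actionOne_xt p l d u g
    rw [h1, AlgHom.id_apply, left_eq_add] at h2
    exact shift_ne_zero p l d u hp hu0 hu hg h2

/-- The action `E^g` itself is not integral. -/
theorem not_restricts [IsDomain R] [IsFractionRing R K] [Fact p.Prime] [CharP R p]
    (hu0 : u ≠ 0) (hu : ¬ IsUnit u) {g : MvPolynomial (Fin (l + 2)) K}
    (hg : g ∈ gRing K p l d u) (hd : ¬ p ∣ d) :
    ¬ Restricts (actionE K p l d u g).toRingHom (intRing R K (l + 2)) := by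
  intro hres
  have hp2 : 2 ≤ p := (Fact.out : p.Prime).two_le
  have hu' : algebraMap R K u ≠ 0 := algebraMap_ne_zero_of_ne_zero hu0
  have : CharP K p := charP_of_injective_algebraMap (IsFractionRing.injective R K) p
  have hinj := map_injective_of_isFractionRing (R := R) (K := K) (l + 2)
  obtain ⟨g', hg'⟩ := exists_map_eq_of_mem_gRing p l d u (by omega) hu' hg
  obtain ⟨q, hq⟩ := hres (MvPolynomial.X 0) ⟨MvPolynomial.X 0, map_X_eq l 0⟩ 1
  have hUV := cst_mul_inv (K := K) l u hu'
  -- Differentiate at `T = 0`: the exponent `p(p-1)` contributes nothing and `pa + 1` contributes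
  -- the factor `1`, so no second term is left to cancel the pole.
  have hcoeff : MvPolynomial.map (algebraMap R K) q = shift p l d u g +
      MvPolynomial.C (algebraMap R K u)⁻¹ ^ 2 * MvPolynomial.X 1 ^ (p * expA p d) *
        ((d : MvPolynomial (Fin (l + 2)) K) * xt K p l d u ^ (d - 1) * shift p l d u g) := by
    rw [hq]
    change (actionE K p l d u g (MvPolynomial.X 0)).coeff 1 = _
    have hV : ∀ k : K, actionE K p l d u g (MvPolynomial.C k) = C (MvPolynomial.C k) :=
      fun k => (actionE K p l d u g).commutes k
    have hc : ∀ P : (MvPolynomial (Fin (l + 2)) K)[X], P.coeff 1 = (derivative P).eval 0 := by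
      intro P
      rw [← coeff_zero_eq_eval_zero, coeff_derivative]
      simp
    have hp0 : ((p : ℕ) : MvPolynomial (Fin (l + 2)) K) = 0 := CharP.cast_eq_zero _ p
    have hy : actionE K p l d u g (MvPolynomial.X 1) = C (yt K p l d u) -
        (C (xt K p l d u) + C (shift p l d u g) * X) ^ d := by
      rw [X_one_eq p l d u, map_sub, map_pow, actionE_xt, actionE_yt]
    have hx : actionE K p l d u g (MvPolynomial.X 0) =
        C (xt K p l d u) + C (shift p l d u g) * X -
          (C (MvPolynomial.C (algebraMap R K u)⁻¹) ^ (p + 1) *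
            (C (yt K p l d u) - (C (xt K p l d u) + C (shift p l d u g) * X) ^ d) ^ (p * (p - 1)) +
          C (MvPolynomial.C (algebraMap R K u)⁻¹) ^ 2 *
            (C (yt K p l d u) - (C (xt K p l d u) + C (shift p l d u g) * X) ^ d) ^
              (p * expA p d + 1)) := by
      rw [X_zero_eq p l d u, map_sub, map_add, map_mul, map_mul, map_pow, map_pow, map_pow,
        map_pow, hV, hy, actionE_xt]
    rw [hc, hx, X_one_eq p l d u]
    simp only [derivative_sub, derivative_add, derivative_mul, derivative_pow, derivative_C,
      derivative_X, eval_sub, eval_add, eval_mul, eval_pow, eval_C, eval_X, eval_neg, Nat.cast_mul,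
      Nat.cast_add, hp0, Nat.cast_one, C_0, C_1, zero_mul, Nat.add_sub_cancel, map_natCast,
      eval_natCast, mul_zero, add_zero, zero_add, mul_one, one_mul, zero_sub]
    ring
  have hdvd : (MvPolynomial.C u : MvPolynomial (Fin (l + 2)) R) ∣
      (d : MvPolynomial (Fin (l + 2)) R) * MvPolynomial.X 1 ^ (p * expA p d) *
        numer p l d u ^ (d - 1) *
        (1 + MvPolynomial.C u * g') := by
    refine ⟨q - MvPolynomial.C u ^ expB p d * (1 + MvPolynomial.C u * g'), hinj ?_⟩
    have hVU : ∀ k : ℕ, cst K l u ^ k * MvPolynomial.C (algebraMap R K u)⁻¹ ^ k = 1 := fun k => by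
      rw [← mul_pow, hUV, one_pow]
    simp only [map_mul, map_sub, map_pow, map_add, map_one, map_natCast, map_X_eq, map_C_eq,
      hcoeff, map_numer p l d u (by omega) hu', hg']
    rw [shift, add_sub_cancel_left, expB, pow_succ (cst K l u) ((p + 1) * (d - 1)), mul_pow,
      ← pow_mul]
    linear_combination (-(d : MvPolynomial (Fin (l + 2)) K) *
      MvPolynomial.X 1 ^ (p * expA p d) * cst K l u ^ ((p + 1) * (d - 1)) *
        xt K p l d u ^ (d - 1) * (1 + cst K l u * g)) * hVU 2
  -- Setting `x = 0` and the other variables to `1` turns `N` into `1 + u^(p-1)`, so the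
  -- divisibility gives `u ∣ d`, although `d` is a unit of `R`.
  let ev : MvPolynomial (Fin (l + 2)) R →+* R :=
    MvPolynomial.eval₂Hom (RingHom.id R) (Fin.cons 0 fun _ => 1)
  have ev0 : ev (MvPolynomial.X 0) = 0 := MvPolynomial.eval₂Hom_X' _ _ _
  have ev1 : ev (MvPolynomial.X 1) = 1 := MvPolynomial.eval₂Hom_X' _ _ _
  have evC : ∀ r, ev (MvPolynomial.C r) = r := fun r => MvPolynomial.eval₂Hom_C _ _ _
  have h1 := map_dvd ev hdvd
  simp only [map_mul, map_add, map_pow, map_natCast, map_one, ev0, ev1, evC, numer, one_pow,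
    mul_one, mul_zero, zero_add] at h1
  have h2 : u ∣ d := by
    have e1 : u ∣ (1 + u ^ (p - 1)) ^ (d - 1) - 1 ^ (d - 1) := by
      refine dvd_trans ?_ (sub_dvd_pow_sub_pow _ _ _)
      rw [add_sub_cancel_left]
      exact dvd_pow_self _ (by omega)
    have e2 : (d : R) = d * (1 + u ^ (p - 1)) ^ (d - 1) * (1 + u * ev g') -
        (d * ((1 + u ^ (p - 1)) ^ (d - 1) - 1 ^ (d - 1)) +
          u * (d * (1 + u ^ (p - 1)) ^ (d - 1) * ev g')) := by
      rw [one_pow]; ring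
    rw [e2]
    exact dvd_sub h1 (dvd_add (dvd_mul_of_dvd_right e1 _) (dvd_mul_right _ _))
  exact hu (isUnit_of_dvd_unit h2 (isUnit_natCast p hd))

theorem specialG_mem : specialG K p l d u ∈ gRing K p l d u :=
  mul_mem (Algebra.subset_adjoin (Set.mem_insert _ _))
    (prod_mem fun i _ => Algebra.subset_adjoin (Set.mem_insert_of_mem _ ⟨i, rfl⟩))

end Integral

/-! ### Stability of the special `g`, and non-exponentiality. -/

section NonExponential

variable {R : Type*} [CommRing R] {K : Type*} [Field K] [Algebra R K]

theorem valuation_map_le_one {Γ : Type*} [LinearOrderedCommGroupWithZero Γ] {n : ℕ}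
    {v₀ : Valuation K Γ} {v : Valuation (MvPolynomial (Fin n) K) Γ}
    (hvC : ∀ a, v (MvPolynomial.C a) = v₀ a) (hvX : ∀ i, v (MvPolynomial.X i) = 1)
    (h : ∀ r : R, v₀ (algebraMap R K r) ≤ 1) (q : MvPolynomial (Fin n) R) :
    v (MvPolynomial.map (algebraMap R K) q) ≤ 1 := by
  induction q using MvPolynomial.induction_on with
  | C a => rw [MvPolynomial.map_C, hvC]; exact h a
  | add p q hp hq => rw [map_add]; exact v.map_add_le hp hq
  | mul_X p i hp => rw [map_mul, MvPolynomial.map_X, map_mul, hvX, mul_one]; exact hp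

/-- Base change of a `G_a`-action on `R[x_1, …, x_n]` over `R` to `K`. -/
theorem exists_baseChange {n : ℕ} {F : MvPolynomial (Fin n) R →+* (MvPolynomial (Fin n) R)[X]}
    (hF : IsGaActionOver R F) :
    ∃ E : MvPolynomial (Fin n) K →ₐ[K] (MvPolynomial (Fin n) K)[X],
      IsGaActionOver K E.toRingHom ∧ ∀ q, E.toRingHom (MvPolynomial.map (algebraMap R K) q) =
        (F q).map (MvPolynomial.map (algebraMap R K)) := by
  let E : MvPolynomial (Fin n) K →ₐ[K] (MvPolynomial (Fin n) K)[X] :=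
    MvPolynomial.aeval fun i => (F (MvPolynomial.X i)).map (MvPolynomial.map (algebraMap R K))
  have hE : ∀ q, E.toRingHom (MvPolynomial.map (algebraMap R K) q) =
      (F q).map (MvPolynomial.map (algebraMap R K)) := by
    have : E.toRingHom.comp (MvPolynomial.map (algebraMap R K)) =
        (mapRingHom (MvPolynomial.map (algebraMap R K))).comp F := by
      apply MvPolynomial.ringHom_ext
      · intro r
        have h1 : F (MvPolynomial.C r) = C (MvPolynomial.C r) := hF.2 r
        have h2 : E.toRingHom (MvPolynomial.C (algebraMap R K r)) =
            C (MvPolynomial.C (algebraMap R K r)) := E.commutes _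
        rw [RingHom.comp_apply, RingHom.comp_apply, h1, coe_mapRingHom, map_C,
          MvPolynomial.map_C, h2]
      · intro i
        rw [RingHom.comp_apply, RingHom.comp_apply, coe_mapRingHom, MvPolynomial.map_X]
        exact MvPolynomial.aeval_X _ i
    exact DFunLike.congr_fun this
  have hK : ∀ r : K, algebraMap K (MvPolynomial (Fin n) K) r ∈ invariants E.toRingHom :=
    fun r => E.commutes r
  refine ⟨E, ⟨isGaAction_of_adjoin _ hK MvPolynomial.adjoin_range_X ?_, hK⟩, hE⟩
  rintro _ ⟨i, rfl⟩
  rw [← MvPolynomial.map_X (algebraMap R K)]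
  exact hF.1.axioms_map hE _

variable [IsDomain R] [IsFractionRing R K] (p l d : ℕ) [Fact p.Prime] (u : R)

/-- The factor criterion applies with `κ = 1`: `u g` is a nonzero product in which `ỹ` and all `z_i`
occur. -/
theorem isStable_specialG (hu0 : u ≠ 0) (hu : ¬ IsUnit u) :
    IsStable K (invRing K p l d u) ⟨1 + cst K l u * specialG K p l d u,
      one_add_mem K p l d u (specialG_mem p l d u)⟩ := by
  have hp : 1 ≤ p := (Fact.out : p.Prime).one_le
  have hu' : algebraMap R K u ≠ 0 := algebraMap_ne_zero_of_ne_zero hu0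
  let U : invRing K p l d u := ⟨cst K l u, cst_mem_invRing p l d u⟩
  let y : invRing K p l d u := ⟨yt K p l d u, yt_mem_invRing p l d u⟩
  let w : Fin l → invRing K p l d u := fun i => ⟨z K l i, z_mem_invRing p l d u i⟩
  have he : (⟨1 + cst K l u * specialG K p l d u,
      one_add_mem K p l d u (specialG_mem p l d u)⟩ : invRing K p l d u) -
        algebraMap K (invRing K p l d u) 1 = U * (U ^ ((p + 1) * d) * y * ∏ i, w i) := by
    apply Subtype.ext
    rw [map_one]
    simp [U, y, w, specialG]
  have hU : U ≠ 0 := by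
    intro h
    have h : cst K l u = 0 := congrArg Subtype.val h
    rw [cst, MvPolynomial.C_eq_zero] at h
    exact hu' h
  have hy : y ≠ 0 := by
    intro h
    have h : yt K p l d u = 0 := congrArg Subtype.val h
    rw [← coords_one, ← coordEquiv_X, map_eq_zero_iff _ (coordEquiv K p l d u).injective] at h
    exact MvPolynomial.X_ne_zero _ h
  have hw : ∀ i, w i ≠ 0 := by
    intro i h
    have h : z K l i = 0 := congrArg Subtype.val h
    exact MvPolynomial.X_ne_zero _ h
  refine isStable_of_factors (κ := (1 : K))
    (fun h => one_add_ne_zero p l d u hp hu0 hu (specialG_mem p l d u) (congrArg Subtype.val h))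
    ?_ (Algebra.adjoin_adjoin_coe_preimage
      (s := insert (yt K p l d u) (Set.range (z K l)))) ?_
  · rw [he]
    exact mul_ne_zero hU (mul_ne_zero (mul_ne_zero (pow_ne_zero _ hU) hy)
      (Finset.prod_ne_zero_iff.2 fun i _ => hw i))
  · rintro a (ha | ⟨i, ha⟩)
    · have ha : a = y := Subtype.ext ha
      rw [he, ha]
      exact dvd_mul_of_dvd_right (dvd_mul_of_dvd_left (dvd_mul_left _ _) _) _
    · have ha : a = w i := Subtype.ext ha.symm
      rw [he, ha]
      exact dvd_mul_of_dvd_right (dvd_mul_of_dvd_right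
        (Finset.dvd_prod_of_mem w (Finset.mem_univ i)) _) _

theorem not_isExponentialOver [CharP R p] (hu0 : u ≠ 0) (hu : ¬ IsUnit u) (hd : ¬ p ∣ d)
    {g : MvPolynomial (Fin (l + 2)) K} (hg : g ∈ gRing K p l d u)
    (hst : IsStable K (invRing K p l d u) ⟨1 + cst K l u * g, one_add_mem K p l d u hg⟩)
    {σ : MvPolynomial (Fin (l + 2)) R ≃ₐ[R] MvPolynomial (Fin (l + 2)) R}
    (hσ : IsRestriction K (evalAt (actionE K p l d u g).toRingHom 1) σ) :
    ¬ IsExponentialOver R σ := by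
  rintro ⟨F, hF, α, hα, hFσ⟩
  have hp : 1 ≤ p := (Fact.out : p.Prime).one_le
  have hu' : algebraMap R K u ≠ 0 := algebraMap_ne_zero_of_ne_zero hu0
  have : CharP K p := charP_of_injective_algebraMap (IsFractionRing.injective R K) p
  obtain ⟨E, hE, hEF⟩ := exists_baseChange (K := K) hF
  have hα' := mem_invariants_map hEF hα
  have hEα : ∀ b, evalAt E.toRingHom (MvPolynomial.map (algebraMap R K) α) b =
      actionOne p l d u g b := by
    have h : evalAt E.toRingHom (MvPolynomial.map (algebraMap R K) α) =
        (actionOne p l d u g).toRingHom := by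
      apply MvPolynomial.ringHom_ext
      · intro r
        exact (evalAt_of_mem _ (hE.2 r)).trans ((actionOne p l d u g).commutes r).symm
      · intro i
        rw [← map_X_eq (R := R), evalAt_map hEF, hFσ, hσ]
        rfl
    exact DFunLike.congr_fun h
  have hyt : E (yt K p l d u) = C (yt K p l d u) :=
    yt_mem_invariants_of_isStable p l d u hu' hg hst hE hα' hEα
  obtain ⟨V, hVR, hVu⟩ := exists_valuation_lt_one (K := K) hu
  obtain ⟨v, hvC, hvX⟩ := exists_mvPolynomial_valuation V.valuation (l + 2)
  have hvint := valuation_map_le_one (R := R) hvC hvX hVR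
  -- `E` need not be `E^g`, so `c` may have any degree in `T`; only `c(0) = 0` and `c(α)` are known.
  obtain ⟨c, hc⟩ : ∃ c, c = E (xt K p l d u) - C (xt K p l d u) := ⟨_, rfl⟩
  have hxt : E (xt K p l d u) = C (xt K p l d u) + c := by rw [hc]; ring
  have hc0 : c.coeff 0 = 0 := by
    rw [hc, coeff_sub, coeff_C_zero, coeff_zero_eq_eval_zero]
    exact sub_eq_zero.2 (hE.1.counit _)
  have hcα : c.eval (MvPolynomial.map (algebraMap R K) α) = shift p l d u g := by
    rw [hc, eval_sub, eval_C]
    have : eval (MvPolynomial.map (algebraMap R K) α) (E (xt K p l d u)) = _ :=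
      hEα (xt K p l d u)
    rw [this, actionOne_xt, add_sub_cancel_left]
  have hcoeff : ∀ (j : Fin (l + 2)) (i : ℕ), v ((E (MvPolynomial.X j)).coeff i) ≤ 1 := by
    intro j i
    have h := hEF (MvPolynomial.X j)
    rw [map_X_eq] at h
    change E (MvPolynomial.X j) = _ at h
    rw [h, coeff_map]
    exact hvint _
  have hEy : E (MvPolynomial.X 1) = C (MvPolynomial.X 1 + xt K p l d u ^ d) -
      (C (xt K p l d u) + c) ^ d := by
    conv_lhs => rw [X_one_eq p l d u]
    rw [map_sub, map_pow, hyt, hxt, yt]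
  have hEx : E (MvPolynomial.X 0) = C (xt K p l d u) + c -
      (C (MvPolynomial.C (algebraMap R K u)⁻¹) ^ (p + 1) *
        (C (MvPolynomial.X 1 + xt K p l d u ^ d) - (C (xt K p l d u) + c) ^ d) ^ (p * (p - 1)) +
      C (MvPolynomial.C (algebraMap R K u)⁻¹) ^ 2 *
        (C (MvPolynomial.X 1 + xt K p l d u ^ d) - (C (xt K p l d u) + c) ^ d) ^
          (p * expA p d + 1)) := by
    have hV : ∀ k : K, E (MvPolynomial.C k) = C (MvPolynomial.C k) := fun k => E.commutes k
    rw [X_zero_eq p l d u, map_sub, map_add, map_mul, map_mul, map_pow, map_pow, map_pow, map_pow,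
      hV, hxt, hEy]
  have hvu : v (cst K l u) < 1 := by rw [cst, hvC]; exact hVu
  have key := valuation_eval_lt p v (U := cst K l u) (V := MvPolynomial.C (algebraMap R K u)⁻¹)
    (X := MvPolynomial.X 0) (Y := MvPolynomial.X 1) (xt := xt K p l d u)
    (α := MvPolynomial.map (algebraMap R K) α) (a := expA p d) (d := d) hc0
    (cst_mul_inv l u hu') hvu (hvX 0).le (hvX 1) (hvint α) hd
    (by rw [xt, lam, map_pow, map_pow]) (by rw [← hEy]; exact hcoeff 1)
    (by rw [← hEx]; exact hcoeff 0)
  obtain ⟨g', rfl⟩ := exists_map_eq_of_mem_gRing p l d u hp hu' hg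
  -- `1 + u g` has value `1`, so the estimate reads `v(u)^b < v(u)^b`.
  rw [hcα, shift, map_mul, map_pow, v.map_one_add_of_lt, mul_one] at key
  · exact absurd key (lt_irrefl _)
  · rw [map_mul]
    exact mul_lt_one_of_lt_of_le hvu (hvint g')

end NonExponential

end GaNonExp

end

theorem theorem4p13 {R K : Type*} [CommRing R] [IsDomain R] [Field K] [Algebra R K]
    [IsFractionRing R K] (p : ℕ) [Fact p.Prime] [CharP R p] (hR : ¬ IsField R) :
    (∀ (l d : ℕ) (u : R), 2 ≤ d → ¬ p ∣ d → u ≠ 0 → ¬ IsUnit u →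
      (∀ (g : MvPolynomial (Fin (l + 2)) K) (hg : g ∈ GaNonExp.gRing K p l d u),
        GaNonExp.IsGaActionOver K (GaNonExp.actionE K p l d u g).toRingHom ∧
        (∃ σ : MvPolynomial (Fin (l + 2)) R ≃ₐ[R] MvPolynomial (Fin (l + 2)) R,
          GaNonExp.IsRestriction K
            (GaNonExp.evalAt (GaNonExp.actionE K p l d u g).toRingHom 1) σ ∧
          orderOf σ = p ∧
          (UniqueFactorizationMonoid R →
            GaNonExp.IsStable K (GaNonExp.invRing K p l d u)
              ⟨1 + GaNonExp.cst K l u * g, GaNonExp.one_add_mem K p l d u hg⟩ →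
            ¬ GaNonExp.IsExponentialOver R σ)) ∧
        ¬ GaNonExp.Restricts (GaNonExp.actionE K p l d u g).toRingHom
          (GaNonExp.intRing R K (l + 2))) ∧
      (∃ hg : GaNonExp.specialG K p l d u ∈ GaNonExp.gRing K p l d u,
        GaNonExp.IsStable K (GaNonExp.invRing K p l d u)
          ⟨1 + GaNonExp.cst K l u * GaNonExp.specialG K p l d u,
            GaNonExp.one_add_mem K p l d u hg⟩ ∧
        (UniqueFactorizationMonoid R →
          ∀ σ : MvPolynomial (Fin (l + 2)) R ≃ₐ[R] MvPolynomial (Fin (l + 2)) R,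
            GaNonExp.IsRestriction K
              (GaNonExp.evalAt (GaNonExp.actionE K p l d u
                (GaNonExp.specialG K p l d u)).toRingHom 1) σ →
            ¬ GaNonExp.IsExponentialOver R σ))) ∧
    (UniqueFactorizationMonoid R → ∀ n : ℕ, 2 ≤ n →
      ∃ σ : MvPolynomial (Fin n) R ≃ₐ[R] MvPolynomial (Fin n) R,
        orderOf σ = p ∧ ¬ GaNonExp.IsExponentialOver R σ) := by
  refine ⟨fun l d u hd2 hd hu0 hu => ⟨fun g hg => ⟨GaNonExp.isGaActionOver_actionE p l d u hg, ?_,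
    GaNonExp.not_restricts p l d u hu0 hu hg hd⟩, GaNonExp.specialG_mem p l d u,
    GaNonExp.isStable_specialG p l d u hu0 hu, fun _ σ hσ =>
      GaNonExp.not_isExponentialOver p l d u hu0 hu hd (GaNonExp.specialG_mem p l d u)
        (GaNonExp.isStable_specialG p l d u hu0 hu) hσ⟩, fun _ n hn => ?_⟩
  · obtain ⟨σ, hσ, hord⟩ := GaNonExp.exists_restriction p l d u hu0 hu hg (by omega)
    exact ⟨σ, hσ, hord, fun _ hst =>
      GaNonExp.not_isExponentialOver p l d u hu0 hu hd hg hst hσ⟩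
  · obtain ⟨l, rfl⟩ := Nat.exists_eq_add_of_le' hn
    obtain ⟨u, hu0, hu⟩ := Ring.exists_not_isUnit_of_not_isField hR
    have hp2 : 2 ≤ p := (Fact.out : p.Prime).two_le
    -- `d = p + 1` is a choice that is prime to `p` and at least `2` for every `p`.
    have hd : ¬ p ∣ p + 1 := fun h => by
      have := Nat.le_of_dvd one_pos ((Nat.dvd_add_right dvd_rfl).1 h)
      omega
    obtain ⟨σ, hσ, hord⟩ := GaNonExp.exists_restriction (K := K) p l (p + 1) u hu0 hu
      (GaNonExp.specialG_mem p l (p + 1) u) (by omega)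
    exact ⟨σ, hord, GaNonExp.not_isExponentialOver p l (p + 1) u hu0 hu hd
      (GaNonExp.specialG_mem p l (p + 1) u)
      (GaNonExp.isStable_specialG p l (p + 1) u hu0 hu) hσ⟩
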